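/- Let $E=(E^0,E^1,r,s)$ be a finite directed graph without sources (every vertex is the range of an edge), let $G$ be a discrete group acting on $E$ by graph automorphisms, and let $\varphi:G\times E^1\to G$ be a one-cocycle, $\varphi(gh,a)=\varphi(g,ha)\varphi(h,a)$, with $\varphi(g,a)\cdot v=g\cdot v$ for all $g\in G$, $a\in E^1$, $v\in E^0$. Finite paths $\alpha=a_1\cdots a_n$ and infinite paths $\xi=a_1a_2\cdots$ satisfy $s(a_i)=r(a_{i+1})$; vertices are the finite paths of length $0$; $d(\alpha)$ and $|\alpha|$ are the source and the length of $\alpha\in E^*$, and $\xi|_n$ is the initial segment of length $n$ of $\xi\in E^\infty$. The action and $\varphi$ are extended to paths by $g(a\alpha)=(ga)(\varphi(g,a)\alpha)$, $\varphi(g,v)=g$ for $v\in E^0$ and $\varphi(g,a\alpha)=\varphi(\varphi(g,a),\alpha)$. Let $\mathcal S_{G,E}=\{(\alpha,g,\beta):\alpha,\beta\in E^*,\ g\in G,\ d(\alpha)=g\,d(\beta)\}\cup\{0\}$, with $$(\alpha,g,\beta)(\gamma,h,\delta)=\begin{cases}(\alpha,\,g\varphi(h^{-1},\varepsilon)^{-1},\,\delta(h^{-1}\varepsilon))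 & \beta=\gamma\varepsilon,\\ (\alpha(g\varepsilon),\,\varphi(g,\varepsilon)h,\,\delta)&\gamma=\beta\varepsilon,\\ 0&\text{otherwise,}\end{cases}\qquad(\alpha,g,\beta)^*=(\beta,g^{-1},\alpha),$$ acting on $E^\infty$ by $(\alpha,g,\beta)\cdot\beta\xi=\alpha(g\xi)$. Let $\mathcal G=\mathcal G_{(G,E)}$ be its groupoid of germs $[\alpha,g,\beta;\beta\xi]$, where $[x;\eta]=[y;\mu]$ iff $\eta=\mu$ and $xe=ye$ for some idempotent $e\neq0$ of $\mathcal S_{G,E}$ with $e\cdot\eta=\eta$, and where $[x;y\eta][y;\eta]=[xy;\eta]$ and $[x;\eta]^{-1}=[x^*;x\eta]$. Its topology is generated by the sets $\{[\alpha,g,\beta;\zeta]:\zeta\in Z(\delta)\}$, $(\alpha,g,\beta)\in\mathcal S_{G,E}$, $\delta\in E^*$, where $Z(\delta)=\{\delta\eta : \eta\in E^\infty\}$. Write $\mathcal G^{(0)}$ for the unit space. Let $\breve G=G^{\mathbb N}/G^{(\mathbb N)}$ be the group of sequences in $G$ modulo those with finitely many entries $\ne1$, let $\breve\rho$ be its automorphism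 induced by the right shift, and let $\ell:\mathcal G\to\breve G\rtimes_{\breve\rho}\mathbb Z$ be the lag cocycle $$\ell([\alpha,g,\beta;\beta\xi])=\big(\breve\rho^{|\alpha|}\big([\varphi(g,\xi|_n)]_{n\ge0}\big),\ |\alpha|-|\beta|\big).$$ A groupoid $\mathcal H$ is principal if its isotropy bundle $\operatorname{Iso}(\mathcal H)=\{\gamma:r(\gamma)=s(\gamma)\}$ equals $\mathcal H^{(0)}$. A topological groupoid $\mathcal H$ is effective if the interior of $\operatorname{Iso}(\mathcal H)$ is $\mathcal H^{(0)}$, and strongly effective if $\mathcal H|_C=\{\gamma: r(\gamma)\in C\}$ is effective for every closed $C\subseteq\mathcal H^{(0)}$ that is invariant ($r(\gamma)\in C\iff s(\gamma)\in C$). Suppose that $\mathcal G$ is Hausdorff, and let $e$ be the identity of $\breve G\rtimes_{\breve\rho}\mathbb Z$. Then: 1. $\ell^{-1}(e)=\{[\alpha,1,\beta;\beta\xi] : \alpha,\beta\in E^*,\ d(\alpha)=d(\beta)=r(\xi),\ |\alpha|=|\beta|\}$. 2. $\ell^{-1}(e)$ is principal. 3. $\mathcal G$ is ample (étale, Hausdorff,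 with locally compact zero-dimensional unit space), and $\ell^{-1}(e)$ is strongly effective. 4. Consequently, if $\ell$ is locally constant, then for every field $K$ the Steinberg algebra $A_K(\mathcal G)$ (locally constant compactly supported functions $\mathcal G\to K$ with convolution) is graded by $\breve G\rtimes_{\breve\rho}\mathbb Z$, with homogeneous subspaces $A_g=\{f\in A_K(\mathcal G): f=0 \text{ outside } \ell^{-1}(g)\}$, and $U\mapsto A_K(\mathcal G|_U)$ is an isomorphism from the lattice of open invariant subsets of $\mathcal G^{(0)}$ onto the lattice of graded ideals of $A_K(\mathcal G)$, that is, of the two-sided ideals $J$ with $J=\bigoplus_g (J\cap A_g)$. -/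

import Mathlib

open Topology

/-! ### Groupoids, ample groupoids, cocycles -/

/-- A (small) groupoid, given by its set of arrows `𝒢`.  The objects are identified with the
identity arrows, so that the range map `r` and the source map `s` take values in `𝒢`.
The product `mul γ δ` has a meaning only for composable pairs, i.e. when `s γ = r δ`. -/
class ArrowGroupoid (𝒢 : Type*) where
  r : 𝒢 → 𝒢
  s : 𝒢 → 𝒢
  mul : 𝒢 → 𝒢 → 𝒢
  inv : 𝒢 → 𝒢
  s_r : ∀ γ, s (r γ) = r γ
  r_s : ∀ γ, r (s γ) = s γ
  r_mul : ∀ γ δ, s γ = r δ → r (mul γ δ) = r γ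
  s_mul : ∀ γ δ, s γ = r δ → s (mul γ δ) = s δ
  mul_assoc : ∀ γ δ ε, s γ = r δ → s δ = r ε → mul (mul γ δ) ε = mul γ (mul δ ε)
  r_mul_self : ∀ γ, mul (r γ) γ = γ
  mul_s_self : ∀ γ, mul γ (s γ) = γ
  r_inv : ∀ γ, r (inv γ) = s γ
  s_inv : ∀ γ, s (inv γ) = r γ
  mul_inv : ∀ γ, mul γ (inv γ) = r γ
  inv_mul : ∀ γ, mul (inv γ) γ = s γ

namespace ArrowGroupoid

section Basic

variable (𝒢 : Type*) [ArrowGroupoid 𝒢]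

/-- The unit space, as a set of arrows. -/
def units : Set 𝒢 := {u | r u = u}

/-- The isotropy bundle. -/
def isotropy : Set 𝒢 := {γ | r γ = s γ}

variable {𝒢}

theorem r_r (γ : 𝒢) : r (r γ) = r γ := by
  have h := r_s (r γ)
  rwa [s_r] at h

theorem s_s (γ : 𝒢) : s (s γ) = s γ := by
  have h := s_r (s γ)
  rwa [r_s] at h

/-- The range map, with values in the unit space. -/
def rng (γ : 𝒢) : units 𝒢 := ⟨r γ, r_r γ⟩

/-- The source map, with values in the unit space. -/
def src (γ : 𝒢) : units 𝒢 := ⟨s γ, r_s γ⟩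

/-- Invariant subsets of the unit space. -/
def IsInvariant (U : Set (units 𝒢)) : Prop := ∀ γ : 𝒢, rng γ ∈ U ↔ src γ ∈ U

variable (𝒢)

/-- `𝒢` is principal if its isotropy bundle is its unit space. -/
def IsPrincipal : Prop := isotropy 𝒢 = units 𝒢

/-- A topological groupoid that is étale, Hausdorff and has a zero-dimensional unit space. -/
structure IsAmple [TopologicalSpace 𝒢] : Prop where
  continuous_inv : Continuous (inv : 𝒢 → 𝒢)
  continuous_mul : Continuous fun p : {p : 𝒢 × 𝒢 // s p.1 = r p.2} => mul p.1.1 p.1.2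
  hausdorff : T2Space 𝒢
  locallyCompact_units : LocallyCompactSpace (units 𝒢)
  isLocalHomeomorph_rng : IsLocalHomeomorph (rng : 𝒢 → units 𝒢)
  zeroDimensional_units : TopologicalSpace.IsTopologicalBasis {U : Set (units 𝒢) | IsClopen U}

/-- `𝒢` is effective if the interior of its isotropy bundle is its unit space. -/
def IsEffective [TopologicalSpace 𝒢] : Prop := interior (isotropy 𝒢) = units 𝒢

/-- A subgroupoid of `𝒢`. -/
structure Sub where
  carrier : Set 𝒢
  r_mem : ∀ γ ∈ carrier, r γ ∈ carrier
  s_mem : ∀ γ ∈ carrier, s γ ∈ carrier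
  mul_mem : ∀ γ ∈ carrier, ∀ δ ∈ carrier, s γ = r δ → mul γ δ ∈ carrier
  inv_mem : ∀ γ ∈ carrier, inv γ ∈ carrier

variable {𝒢}

open scoped Classical in
/-- A subgroupoid is a groupoid, with the operations of `𝒢`. -/
noncomputable instance (H : Sub 𝒢) : ArrowGroupoid H.carrier where
  r γ := ⟨r γ.1, H.r_mem _ γ.2⟩
  s γ := ⟨s γ.1, H.s_mem _ γ.2⟩
  mul γ δ := if h : s γ.1 = r δ.1 then ⟨mul γ.1 δ.1, H.mul_mem _ γ.2 _ δ.2 h⟩ else γ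
  inv γ := ⟨inv γ.1, H.inv_mem _ γ.2⟩
  s_r γ := Subtype.ext (s_r γ.1)
  r_s γ := Subtype.ext (r_s γ.1)
  r_mul γ δ h := by
    have h' : s γ.1 = r δ.1 := congrArg Subtype.val h
    simp only [dif_pos h']
    exact Subtype.ext (r_mul _ _ h')
  s_mul γ δ h := by
    have h' : s γ.1 = r δ.1 := congrArg Subtype.val h
    simp only [dif_pos h']
    exact Subtype.ext (s_mul _ _ h')
  mul_assoc γ δ ε h k := by
    have h' : s γ.1 = r δ.1 := congrArg Subtype.val h
    have k' : s δ.1 = r ε.1 := congrArg Subtype.val k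
    have h1 : s (mul γ.1 δ.1) = r ε.1 := (s_mul _ _ h').trans k'
    have h2 : s γ.1 = r (mul δ.1 ε.1) := h'.trans (r_mul _ _ k').symm
    simp only [dif_pos h', dif_pos k', dif_pos h1, dif_pos h2]
    exact Subtype.ext (mul_assoc _ _ _ h' k')
  r_mul_self γ := by
    simp only [dif_pos (s_r γ.1)]
    exact Subtype.ext (r_mul_self _)
  mul_s_self γ := by
    simp only [dif_pos (r_s γ.1).symm]
    exact Subtype.ext (mul_s_self _)
  r_inv γ := Subtype.ext (r_inv γ.1)
  s_inv γ := Subtype.ext (s_inv γ.1)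
  mul_inv γ := by
    simp only [dif_pos (r_inv γ.1).symm]
    exact Subtype.ext (mul_inv _)
  inv_mul γ := by
    simp only [dif_pos (s_inv γ.1)]
    exact Subtype.ext (inv_mul _)

/-- The restriction `𝒢|_U` of `𝒢` to an invariant set of units. -/
def restrict (U : Set (units 𝒢)) (hU : IsInvariant U) : Sub 𝒢 where
  carrier := {γ | rng γ ∈ U}
  r_mem γ h := by
    have : rng (r γ) = rng γ := Subtype.ext (r_r γ)
    simpa only [Set.mem_ofPred_eq, this] using h
  s_mem γ h := by
    have : rng (s γ) = src γ := Subtype.ext (r_s γ)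
    simpa only [Set.mem_ofPred_eq, this] using (hU γ).1 h
  mul_mem γ h δ _ hc := by
    have : rng (mul γ δ) = rng γ := Subtype.ext (r_mul _ _ hc)
    simpa only [Set.mem_ofPred_eq, this] using h
  inv_mem γ h := by
    have : rng (inv γ) = src γ := Subtype.ext (r_inv γ)
    simpa only [Set.mem_ofPred_eq, this] using (hU γ).1 h

variable (𝒢) in
/-- `𝒢` is strongly effective if `𝒢|_C` (with the relative topology) is effective for every
closed invariant set `C` of units. -/
def IsStronglyEffective [TopologicalSpace 𝒢] : Prop :=
  ∀ (C : Set (units 𝒢)) (hC : IsInvariant C), IsClosed C → IsEffective (restrict C hC).carrier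

variable (𝒢) in
/-- A cocycle on `𝒢` with values in the group `Γ`. -/
structure Cocycle (Γ : Type*) [Group Γ] where
  toFun : 𝒢 → Γ
  map_mul : ∀ γ δ, s γ = r δ → toFun (mul γ δ) = toFun γ * toFun δ

namespace Cocycle

variable {Γ : Type*} [Group Γ] (c : Cocycle 𝒢 Γ)

instance : CoeFun (Cocycle 𝒢 Γ) fun _ => 𝒢 → Γ := ⟨toFun⟩

theorem map_r (γ : 𝒢) : c (r γ) = 1 := by
  have h := c.map_mul (r γ) γ (s_r γ)
  rw [r_mul_self] at h
  exact right_eq_mul.1 h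

theorem map_s (γ : 𝒢) : c (s γ) = 1 := by rw [← r_inv, map_r]

theorem map_inv (γ : 𝒢) : c (inv γ) = (c γ)⁻¹ := by
  have h := c.map_mul (inv γ) γ (s_inv γ)
  rw [inv_mul, map_s] at h
  exact eq_inv_of_mul_eq_one_left h.symm

/-- The subgroupoid `c⁻¹(e)`, where `e` is the identity of `Γ`. -/
def ker : Sub 𝒢 where
  carrier := {γ | c γ = 1}
  r_mem γ _ := c.map_r γ
  s_mem γ _ := c.map_s γ
  mul_mem γ h δ k hc := by
    simp only [Set.mem_ofPred_eq] at h k ⊢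
    rw [c.map_mul _ _ hc, h, k, one_mul]
  inv_mem γ h := by
    simp only [Set.mem_ofPred_eq] at h ⊢
    rw [c.map_inv, h, inv_one]

end Cocycle

end Basic

/-! ### Steinberg algebras, gradings, graded ideals -/

section Steinberg

variable (K : Type*) [Field K] (𝒢 : Type*) [TopologicalSpace 𝒢]

/-- The Steinberg algebra `A_K(𝒢)` of a Hausdorff ample groupoid, as a vector space:
locally constant functions with compact support. -/
def steinberg : Submodule K (𝒢 → K) where
  carrier := {f | IsLocallyConstant f ∧ IsCompact (Function.support f)}
  zero_mem' := ⟨IsLocallyConstant.const 0, by simp⟩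
  add_mem' := by
    rintro f g ⟨hf, hf'⟩ ⟨hg, hg'⟩
    refine ⟨hf.add hg, (hf'.union hg').of_isClosed_subset ?_ (Function.support_add f g)⟩
    exact ((hf.add hg).isClopen_fiber 0).compl.isClosed
  smul_mem' := by
    rintro a f ⟨hf, hf'⟩
    have h : IsLocallyConstant (a • f) := hf.comp (a • ·)
    refine ⟨h, hf'.of_isClosed_subset (h.isClopen_fiber 0).compl.isClosed ?_⟩
    exact Function.support_const_smul_subset a f

/-- For `W ⊆ 𝒢` open, the subspace `C_c(W, K)` of `A_K(𝒢)`, functions on `W` being extended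
by zero; if `W` is an open subgroupoid then this is `A_K(W)`. -/
def steinbergOn (W : Set 𝒢) : Submodule K (𝒢 → K) where
  carrier := {f | f ∈ steinberg K 𝒢 ∧ ∀ γ ∉ W, f γ = 0}
  zero_mem' := ⟨zero_mem _, fun _ _ => rfl⟩
  add_mem' := by
    rintro f g ⟨hf, hf'⟩ ⟨hg, hg'⟩
    exact ⟨add_mem hf hg, fun γ h => by simp [hf' γ h, hg' γ h]⟩
  smul_mem' := by
    rintro a f ⟨hf, hf'⟩
    exact ⟨Submodule.smul_mem _ a hf, fun γ h => by simp [hf' γ h]⟩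

variable {K 𝒢} [ArrowGroupoid 𝒢]

/-- The convolution product.  For `f`, `g` in the Steinberg algebra of a Hausdorff ample groupoid
the sum has only finitely many nonzero terms. -/
noncomputable def conv (f g : 𝒢 → K) (γ : 𝒢) : K :=
  ∑ᶠ p : {p : 𝒢 × 𝒢 // s p.1 = r p.2 ∧ mul p.1 p.2 = γ}, f p.1.1 * g p.1.2

/-- Two-sided ideals of the Steinberg algebra. -/
structure IsIdeal (J : Submodule K (𝒢 → K)) : Prop where
  le : J ≤ steinberg K 𝒢
  conv_mem_left : ∀ f ∈ steinberg K 𝒢, ∀ g ∈ J, conv f g ∈ J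
  conv_mem_right : ∀ f ∈ steinberg K 𝒢, ∀ g ∈ J, conv g f ∈ J

variable {Γ : Type*} [Group Γ]

variable (K) in
/-- The homogeneous subspace `A_g = C_c(c⁻¹(g), K)` of `A_K(𝒢)`. -/
def homogeneous (c : Cocycle 𝒢 Γ) (g : Γ) : Submodule K (𝒢 → K) :=
  steinbergOn K 𝒢 {γ | c γ = g}

variable (K) in
/-- `A_K(𝒢)` is the direct sum of the subspaces `A_g`, and `A_g A_h ⊆ A_{gh}`. -/
structure IsGrading (A : Γ → Submodule K (𝒢 → K)) : Prop where
  independent : iSupIndep A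
  iSup_eq : ⨆ g, A g = steinberg K 𝒢
  conv_mem : ∀ g h, ∀ f ∈ A g, ∀ f' ∈ A h, conv f f' ∈ A (g * h)

/-- Graded ideals: two-sided ideals `J` that are the (automatically direct) sum of the
subspaces `J ∩ A_g`. -/
def IsGradedIdeal (A : Γ → Submodule K (𝒢 → K)) (J : Submodule K (𝒢 → K)) : Prop :=
  IsIdeal J ∧ J = ⨆ g, J ⊓ A g

end Steinberg

end ArrowGroupoid

/-! ### The lag group -/

section LagGroup

variable (G : Type*) [Group G]

/-- The sequences in `G` with only finitely many entries different from `1`. -/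
def finSeq : Subgroup (ℕ → G) where
  carrier := {x | (Function.mulSupport x).Finite}
  one_mem' := by simp
  mul_mem' hx hy := (hx.union hy).subset (Function.mulSupport_mul _ _)
  inv_mem' hx := by simpa using hx

instance finSeq_normal : (finSeq G).Normal where
  conj_mem x hx y := by
    refine Set.Finite.subset (s := Function.mulSupport x) hx ?_
    intro n hn h
    simp only [Function.mem_mulSupport, ne_eq, Pi.mul_apply, Pi.inv_apply] at hn h
    simp [h] at hn

/-- The corona group `G^∞ / G^(∞)`. -/
abbrev Corona : Type _ := (ℕ → G) ⧸ finSeq G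

variable {G}

theorem Corona.mk_eq_mk {x y : ℕ → G} :
    (QuotientGroup.mk x : Corona G) = QuotientGroup.mk y ↔ ∃ N, ∀ n ≥ N, x n = y n := by
  rw [QuotientGroup.eq]
  constructor
  · intro h
    obtain ⟨N, hN⟩ := Set.Finite.bddAbove (s := Function.mulSupport (x⁻¹ * y)) h
    refine ⟨N + 1, fun n hn => ?_⟩
    by_contra hne
    have : n ∈ Function.mulSupport (x⁻¹ * y) := by
      simp only [Function.mem_mulSupport, Pi.mul_apply, Pi.inv_apply, ne_eq]
      intro h1
      exact hne (inv_mul_eq_one.1 h1)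
    have := hN this
    omega
  · rintro ⟨N, hN⟩
    refine Set.Finite.subset (Set.finite_lt_nat N) ?_
    intro n hn
    by_contra hlt
    apply hn
    simp [hN n (not_lt.1 hlt)]

/-- The right shift on sequences. -/
def rshift : (ℕ → G) →* (ℕ → G) where
  toFun x n := if n = 0 then 1 else x (n - 1)
  map_one' := by ext n; simp
  map_mul' x y := by ext n; by_cases h : n = 0 <;> simp [h]

/-- The left shift on sequences. -/
def lshift : (ℕ → G) →* (ℕ → G) where
  toFun x n := x (n + 1)
  map_one' := rfl
  map_mul' _ _ := rfl

theorem mk_rshift_congr (x : ℕ → G) (hx : x ∈ finSeq G) : rshift x ∈ finSeq G := by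
  have h : (QuotientGroup.mk 1 : Corona G) = QuotientGroup.mk x :=
    QuotientGroup.eq.2 (by simpa using hx)
  obtain ⟨N, hN⟩ := Corona.mk_eq_mk.1 h
  have h' : (QuotientGroup.mk 1 : Corona G) = QuotientGroup.mk (rshift x) := by
    refine Corona.mk_eq_mk.2 ⟨N + 1, fun n hn => ?_⟩
    have h0 : n ≠ 0 := by omega
    simp only [rshift, MonoidHom.coe_mk, OneHom.coe_mk, h0, if_false]
    exact hN (n - 1) (by omega)
  simpa using QuotientGroup.eq.1 h'

theorem mk_lshift_congr (x : ℕ → G) (hx : x ∈ finSeq G) : lshift x ∈ finSeq G := by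
  have h : (QuotientGroup.mk 1 : Corona G) = QuotientGroup.mk x :=
    QuotientGroup.eq.2 (by simpa using hx)
  obtain ⟨N, hN⟩ := Corona.mk_eq_mk.1 h
  have h' : (QuotientGroup.mk 1 : Corona G) = QuotientGroup.mk (lshift x) :=
    Corona.mk_eq_mk.2 ⟨N, fun n hn => hN (n + 1) (by omega)⟩
  simpa using QuotientGroup.eq.1 h'

variable (G) in
/-- The automorphism of the corona group induced by the right shift; its inverse is induced by
the left shift. -/
def coronaShift : MulAut (Corona G) where
  toFun := QuotientGroup.map (finSeq G) (finSeq G) rshift mk_rshift_congr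
  invFun := QuotientGroup.map (finSeq G) (finSeq G) lshift mk_lshift_congr
  left_inv x := by
    induction x using QuotientGroup.induction_on with
    | H x => rfl
  right_inv x := by
    induction x using QuotientGroup.induction_on with
    | H x =>
      refine Corona.mk_eq_mk.2 ⟨1, fun n hn => ?_⟩
      have h0 : n ≠ 0 := by omega
      simp only [rshift, lshift, MonoidHom.coe_mk, OneHom.coe_mk, h0, if_false]
      congr 1
      omega
  map_mul' := map_mul _

variable (G) in
/-- The action of `ℤ` on the corona group by powers of the shift. -/
def coronaAction : Multiplicative ℤ →* MulAut (Corona G) := zpowersHom _ (coronaShift G)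

theorem coronaAction_neg (m : ℕ) (x : ℕ → G) :
    coronaAction G (Multiplicative.ofAdd (-(m : ℤ))) (QuotientGroup.mk x : Corona G) =
      QuotientGroup.mk fun n => x (m + n) := by
  induction m generalizing x with
  | zero => simp
  | succ m ih =>
    have e : (Multiplicative.ofAdd (-((m + 1 : ℕ) : ℤ))) =
        Multiplicative.ofAdd (-(m : ℤ)) * Multiplicative.ofAdd (-1 : ℤ) := by
      rw [← ofAdd_add]
      congr 1
      push_cast
      ring
    have e1 : coronaAction G (Multiplicative.ofAdd (-1 : ℤ)) (QuotientGroup.mk x : Corona G) =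
        QuotientGroup.mk (lshift x) := by
      change ((coronaShift G) ^ (-1 : ℤ)) _ = _
      rw [zpow_neg_one]
      rfl
    rw [e, map_mul, MulAut.mul_apply, e1, ih]
    congr 1
    funext n
    change x (m + n + 1) = x (m + 1 + n)
    congr 1
    omega

theorem coronaAction_eq_iff (a b : ℕ) (x y : ℕ → G) :
    coronaAction G (Multiplicative.ofAdd (a : ℤ)) (QuotientGroup.mk x : Corona G) =
      coronaAction G (Multiplicative.ofAdd (b : ℤ)) (QuotientGroup.mk y : Corona G) ↔
    ∃ N, ∀ n ≥ N, x (b + n) = y (a + n) := by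
  have key : ∀ (c d : ℤ) (z : Corona G),
      coronaAction G (Multiplicative.ofAdd c) (coronaAction G (Multiplicative.ofAdd d) z) =
        coronaAction G (Multiplicative.ofAdd (c + d)) z := by
    intro c d z
    rw [ofAdd_add, map_mul, MulAut.mul_apply]
  have e1 : -(a + b : ℤ) + a = -b := by ring
  have e2 : -(a + b : ℤ) + b = -a := by ring
  rw [← Corona.mk_eq_mk (x := fun n => x (b + n)), ← coronaAction_neg, ← coronaAction_neg,
    ← (coronaAction G (Multiplicative.ofAdd (-(a + b : ℤ)))).injective.eq_iff, key, key, e1, e2]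

variable (G) in
/-- The lag group: the semidirect product of the corona group by `ℤ`. -/
abbrev LagGroup : Type _ := Corona G ⋊[coronaAction G] Multiplicative ℤ

end LagGroup

/-! ### Groups acting on graphs -/

/-- The basic data: a directed graph with vertex set `V` and edge set `E`, without sources
(every vertex is the range of some edge), on which `G` acts by graph automorphisms, and a
one-cocycle `φ : G × E → G` with `φ(g, a) • v = g • v`. -/
structure GraphTriple (G V E : Type*) [Group G] [MulAction G V] [MulAction G E] where
  r : E → V
  s : E → V
  r_smul : ∀ (g : G) (a : E), r (g • a) = g • r a
  s_smul : ∀ (g : G) (a : E), s (g • a) = g • s a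
  φ : G → E → G
  φ_mul : ∀ (g h : G) (a : E), φ (g * h) a = φ g (h • a) * φ h a
  φ_smul : ∀ (g : G) (a : E) (v : V), φ g a • v = g • v
  no_sources : ∀ v : V, ∃ a : E, r a = v

namespace GraphTriple

section

variable {G V E : Type*} [Group G] [MulAction G V] [MulAction G E] (T : GraphTriple G V E)

/-- `a₁ a₂ ⋯ aₙ` is a path with range `v`, i.e. `r a₁ = v` and `s aᵢ = r aᵢ₊₁`. -/
def IsPath : V → List E → Prop
  | _, [] => True
  | v, a :: l => T.r a = v ∧ IsPath (T.s a) l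

/-- The source `d(α)` of the path `α` with range `v` and the given list of edges. -/
def endpoint : V → List E → V
  | v, [] => v
  | _, a :: l => endpoint (T.s a) l

/-- The action of `G` on finite paths: `g (a α) = (g a) (φ(g, a) α)`. -/
def actList : G → List E → List E
  | _, [] => []
  | g, a :: l => g • a :: actList (T.φ g a) l

/-- The extension of `φ` to finite paths: `φ(g, v) = g` for paths `v` of length zero,
and `φ(g, a α) = φ(φ(g, a), α)`. -/
def cocList : G → List E → G
  | g, [] => g
  | g, a :: l => cocList (T.φ g a) l

theorem cocList_append (g : G) (l m : List E) :
    T.cocList g (l ++ m) = T.cocList (T.cocList g l) m := by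
  induction l generalizing g with
  | nil => rfl
  | cons a l ih => exact ih _

theorem cocList_smul (g : G) (l : List E) (v : V) : T.cocList g l • v = g • v := by
  induction l generalizing g with
  | nil => rfl
  | cons a l ih => exact (ih _).trans (T.φ_smul g a v)

theorem length_actList (g : G) (l : List E) : (T.actList g l).length = l.length := by
  induction l generalizing g with
  | nil => rfl
  | cons a l ih => simp [actList, ih]

theorem isPath_append {v : V} {l m : List E} (hl : T.IsPath v l)
    (hm : T.IsPath (T.endpoint v l) m) : T.IsPath v (l ++ m) := by
  induction l generalizing v with
  | nil => exact hm
  | cons a l ih => exact ⟨hl.1, ih hl.2 hm⟩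

theorem endpoint_append (v : V) (l m : List E) :
    T.endpoint v (l ++ m) = T.endpoint (T.endpoint v l) m := by
  induction l generalizing v with
  | nil => rfl
  | cons a l ih => exact ih _

theorem isPath_actList (g h : G) {v : V} {l : List E} (hg : ∀ w : V, g • w = h • w)
    (hl : T.IsPath v l) : T.IsPath (h • v) (T.actList g l) := by
  induction l generalizing v g with
  | nil => trivial
  | cons a l ih =>
    refine ⟨by rw [T.r_smul, hl.1, hg], ?_⟩
    rw [T.s_smul, hg]
    exact ih _ (fun w => (T.φ_smul g a w).trans (hg w)) hl.2

theorem endpoint_actList (g h : G) (v : V) (l : List E) (hg : ∀ w : V, g • w = h • w) :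
    T.endpoint (h • v) (T.actList g l) = h • T.endpoint v l := by
  induction l generalizing v g with
  | nil => rfl
  | cons a l ih =>
    change T.endpoint (T.s (g • a)) (T.actList (T.φ g a) l) = h • T.endpoint (T.s a) l
    rw [T.s_smul, hg]
    exact ih _ _ (fun w => (T.φ_smul g a w).trans (hg w))

/-- The finite paths of the graph (including the vertices, as the paths of length zero). -/
@[ext]
structure FinPath where
  rng : V
  edges : List E
  valid : T.IsPath rng edges

/-- The infinite paths `a₀ a₁ a₂ ⋯` of the graph. -/
@[ext]
structure InfPath where
  edge : ℕ → E
  valid : ∀ n, T.s (edge n) = T.r (edge (n + 1))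

variable {T}

namespace FinPath

/-- The source `d(α)` of a finite path. -/
def src (α : T.FinPath) : V := T.endpoint α.rng α.edges

/-- The length `|α|` of a finite path. -/
def length (α : T.FinPath) : ℕ := α.edges.length

/-- The concatenation `αβ` of finite paths. -/
def append (α β : T.FinPath) (h : α.src = β.rng) : T.FinPath where
  rng := α.rng
  edges := α.edges ++ β.edges
  valid := T.isPath_append α.valid (by
    have hb := β.valid
    rw [← h] at hb
    exact hb)

theorem src_append (α β : T.FinPath) (h : α.src = β.rng) : (α.append β h).src = β.src := by
  have h' : T.endpoint α.rng α.edges = β.rng := h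
  simp only [src, append, endpoint_append, h']

/-- The action of `G` on finite paths. -/
def act (g : G) (α : T.FinPath) : T.FinPath where
  rng := g • α.rng
  edges := T.actList g α.edges
  valid := T.isPath_actList g g (fun _ => rfl) α.valid

theorem src_act (g : G) (α : T.FinPath) : (α.act g).src = g • α.src :=
  T.endpoint_actList g g _ _ fun _ => rfl

/-- The extension of `φ` to finite paths. -/
def coc (g : G) (α : T.FinPath) : G := T.cocList g α.edges

theorem coc_smul (g : G) (α : T.FinPath) (v : V) : α.coc g • v = g • v :=
  T.cocList_smul g _ v

/-- The path of length zero at a vertex. -/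
def ofVertex (v : V) : T.FinPath := ⟨v, [], trivial⟩

end FinPath

namespace InfPath

/-- The range of an infinite path. -/
def rng (ξ : T.InfPath) : V := T.r (ξ.edge 0)

/-- The list of the first `n` edges of `ξ`. -/
def take (ξ : T.InfPath) (n : ℕ) : List E := (List.range n).map ξ.edge

theorem take_succ (ξ : T.InfPath) (n : ℕ) : ξ.take (n + 1) = ξ.take n ++ [ξ.edge n] := by
  simp [take, List.range_succ]

/-- The action of `G` on infinite paths, `(gξ)ₙ = φ(g, ξ|ₙ) ξₙ`: it is the only map such that the
initial segments of `gξ` are the paths `g (ξ|ₙ)`. -/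
def act (g : G) (ξ : T.InfPath) : T.InfPath where
  edge n := T.cocList g (ξ.take n) • ξ.edge n
  valid n := by rw [T.s_smul, T.r_smul, cocList_smul, cocList_smul, ξ.valid]

/-- The sequence `Φ(g, ξ)` with entries `φ(g, ξ|ₙ)`, `n = 0, 1, 2, …`. -/
def Phi (g : G) (ξ : T.InfPath) : ℕ → G := fun n => T.cocList g (ξ.take n)

theorem rng_act (g : G) (ξ : T.InfPath) : (ξ.act g).rng = g • ξ.rng := by
  simp [rng, act, take, cocList, T.r_smul]

end InfPath

theorem prepend_valid {v : V} {l : List E} (hl : T.IsPath v l) (ξ : T.InfPath)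
    (h : T.endpoint v l = ξ.rng) :
    T.r (l.getD 0 (ξ.edge (0 - l.length))) = v ∧
    ∀ n, T.s (l.getD n (ξ.edge (n - l.length))) =
      T.r (l.getD (n + 1) (ξ.edge (n + 1 - l.length))) := by
  induction l generalizing v with
  | nil => exact ⟨h.symm, fun n => by simpa using ξ.valid n⟩
  | cons a l ih =>
    obtain ⟨h1, h2⟩ := ih hl.2 h
    refine ⟨by simpa using hl.1, fun n => ?_⟩
    cases n with
    | zero => simpa using h1.symm
    | succ n => simpa using h2 n

/-- The infinite path `αξ`. -/
def FinPath.prepend (α : T.FinPath) (ξ : T.InfPath) (h : α.src = ξ.rng) : T.InfPath where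
  edge n := α.edges.getD n (ξ.edge (n - α.length))
  valid := (prepend_valid α.valid ξ h).2

theorem FinPath.rng_prepend (α : T.FinPath) (ξ : T.InfPath) (h : α.src = ξ.rng) :
    (α.prepend ξ h).rng = α.rng := (prepend_valid α.valid ξ h).1

/-! Calculation rules for paths, used to see that the groupoid of germs is well defined. -/

theorem φ_one (a : E) : T.φ 1 a = 1 := by
  have h := T.φ_mul 1 1 a
  simpa using h

theorem cocList_one (l : List E) : T.cocList 1 l = 1 := by
  induction l with
  | nil => rfl
  | cons a l ih => simpa [cocList, T.φ_one] using ih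

theorem cocList_mul (g h : G) (l : List E) :
    T.cocList (g * h) l = T.cocList g (T.actList h l) * T.cocList h l := by
  induction l generalizing g h with
  | nil => rfl
  | cons a l ih => simp [cocList, actList, T.φ_mul, ih]

theorem actList_append (g : G) (l m : List E) :
    T.actList g (l ++ m) = T.actList g l ++ T.actList (T.cocList g l) m := by
  induction l generalizing g with
  | nil => rfl
  | cons a l ih => simp [cocList, actList, ih]

theorem actList_mul (g h : G) (l : List E) :
    T.actList (g * h) l = T.actList g (T.actList h l) := by
  induction l generalizing g h with
  | nil => rfl
  | cons a l ih => simp [actList, T.φ_mul, ih, mul_smul]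

theorem actList_one (l : List E) : T.actList 1 l = l := by
  induction l with
  | nil => rfl
  | cons a l ih => simp [actList, T.φ_one, ih]

namespace FinPath

theorem act_mul (g h : G) (ε : T.FinPath) : ε.act (g * h) = (ε.act h).act g :=
  FinPath.ext (mul_smul _ _ _) (T.actList_mul _ _ _)

theorem act_one (ε : T.FinPath) : ε.act (1 : G) = ε :=
  FinPath.ext (one_smul _ _) (T.actList_one _)

theorem coc_one (ε : T.FinPath) : ε.coc (1 : G) = 1 := T.cocList_one _

theorem coc_inv_act (g : G) (ε : T.FinPath) : (ε.act g).coc g⁻¹ = (ε.coc g)⁻¹ := by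
  have h := T.cocList_mul g⁻¹ g ε.edges
  rw [inv_mul_cancel, cocList_one] at h
  exact eq_inv_of_mul_eq_one_left h.symm

theorem length_append (α β : T.FinPath) (h : α.src = β.rng) :
    (α.append β h).length = α.length + β.length := List.length_append

theorem length_act (g : G) (α : T.FinPath) : (α.act g).length = α.length := T.length_actList _ _

theorem append_cancel {α ε ε' : T.FinPath} {h : α.src = ε.rng} {h' : α.src = ε'.rng}
    (e : α.append ε h = α.append ε' h') : ε = ε' :=
  FinPath.ext (h.symm.trans h') (List.append_cancel_left (congrArg FinPath.edges e))

end FinPath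

namespace InfPath

theorem act_mul (g h : G) (ξ : T.InfPath) : ξ.act (g * h) = (ξ.act h).act g := by
  have key : ∀ n, (ξ.act h).take n = T.actList h (ξ.take n) := by
    intro n
    induction n with
    | zero => rfl
    | succ n ih => rw [take_succ, take_succ, actList_append, ih]; rfl
  ext n
  change T.cocList (g * h) _ • _ = T.cocList g ((ξ.act h).take n) • (T.cocList h _ • _)
  rw [key, cocList_mul, mul_smul]

theorem Phi_mul (g h : G) (ξ : T.InfPath) :
    ξ.Phi (g * h) = (ξ.act h).Phi g * ξ.Phi h := by
  have key : ∀ n, (ξ.act h).take n = T.actList h (ξ.take n) := by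
    intro n
    induction n with
    | zero => rfl
    | succ n ih => rw [take_succ, take_succ, actList_append, ih]; rfl
  funext n
  change T.cocList (g * h) _ = T.cocList g ((ξ.act h).take n) * T.cocList h _
  rw [key, cocList_mul]

theorem act_one (ξ : T.InfPath) : ξ.act (1 : G) = ξ := by
  ext n
  change T.cocList 1 _ • _ = _
  rw [cocList_one, one_smul]

theorem Phi_one (ξ : T.InfPath) : ξ.Phi (1 : G) = 1 := funext fun _ => T.cocList_one _

end InfPath

theorem FinPath.prepend_edge_add (α : T.FinPath) (ξ : T.InfPath) (h : α.src = ξ.rng) (n : ℕ) :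
    (α.prepend ξ h).edge (α.length + n) = ξ.edge n := by
  simp [prepend, length]

theorem FinPath.prepend_edge_lt (α : T.FinPath) (ξ : T.InfPath) (h : α.src = ξ.rng) (n : ℕ)
    (hn : n < α.edges.length) : (α.prepend ξ h).edge n = α.edges[n] := by
  simp [prepend, hn]

theorem FinPath.take_prepend (α : T.FinPath) (ξ : T.InfPath) (h : α.src = ξ.rng) (n : ℕ) :
    (α.prepend ξ h).take (α.length + n) = α.edges ++ ξ.take n := by
  induction n with
  | zero =>
    refine List.ext_getElem (by simp [InfPath.take, length]) fun i h1 h2 => ?_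
    have h3 : i < α.edges.length := by simpa [InfPath.take, length] using h1
    simp [InfPath.take, prepend_edge_lt _ _ _ _ h3]
  | succ n ih =>
    rw [← add_assoc, InfPath.take_succ, ih, InfPath.take_succ, prepend_edge_add, List.append_assoc]

theorem InfPath.ext_take {ξ η : T.InfPath} (h : ∀ n, ξ.take n = η.take n) : ξ = η := by
  ext n
  have h1 := h (n + 1)
  rw [take_succ, take_succ, h n] at h1
  simpa using h1

theorem InfPath.take_take (ξ : T.InfPath) {m n : ℕ} (h : m ≤ n) :
    (ξ.take n).take m = ξ.take m := by
  simp [take, ← List.map_take, List.take_range, h]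

theorem InfPath.ext_take_add {ξ η : T.InfPath} (k : ℕ)
    (h : ∀ n, ξ.take (k + n) = η.take (k + n)) : ξ = η := by
  refine ext_take fun n => ?_
  rw [← take_take ξ (Nat.le_add_left n k), ← take_take η (Nat.le_add_left n k), h]

theorem FinPath.prepend_append (α ε : T.FinPath) (ξ : T.InfPath) (h : α.src = ε.rng)
    (h' : (α.append ε h).src = ξ.rng) :
    (α.append ε h).prepend ξ h' = α.prepend (ε.prepend ξ (by rw [← h', src_append]))
      (by rw [rng_prepend, h]) := by
  refine InfPath.ext_take_add (α.length + ε.length) fun n => ?_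
  rw [← length_append _ _ h, take_prepend, length_append, add_assoc, take_prepend, take_prepend]
  simp [append]

theorem FinPath.prepend_inj {α : T.FinPath} {ξ η : T.InfPath} {h : α.src = ξ.rng}
    {h' : α.src = η.rng} (e : α.prepend ξ h = α.prepend η h') : ξ = η := by
  ext n
  rw [← α.prepend_edge_add ξ h, e, prepend_edge_add]

theorem InfPath.take_act (g : G) (ξ : T.InfPath) (n : ℕ) :
    (ξ.act g).take n = T.actList g (ξ.take n) := by
  induction n with
  | zero => rfl
  | succ n ih => rw [take_succ, take_succ, actList_append, ih]; rfl

theorem FinPath.act_prepend (g : G) (ε : T.FinPath) (ξ : T.InfPath) (h : ε.src = ξ.rng) :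
    (ε.prepend ξ h).act g = (ε.act g).prepend (ξ.act (ε.coc g))
      (by rw [src_act, InfPath.rng_act, coc_smul, h]) := by
  refine InfPath.ext_take_add ε.length fun n => ?_
  rw [InfPath.take_act, take_prepend, actList_append]
  conv_rhs => rw [← length_act g ε, take_prepend, InfPath.take_act]
  rfl

theorem FinPath.Phi_prepend (g : G) (ε : T.FinPath) (ξ : T.InfPath) (h : ε.src = ξ.rng) (n : ℕ) :
    (ε.prepend ξ h).Phi g (ε.length + n) = ξ.Phi (ε.coc g) n := by
  unfold InfPath.Phi
  rw [take_prepend, cocList_append]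
  rfl

theorem InfPath.isPath_take (ξ : T.InfPath) (n : ℕ) : T.IsPath ξ.rng (ξ.take n) ∧
    T.endpoint ξ.rng (ξ.take n) = T.r (ξ.edge n) := by
  induction n with
  | zero => exact ⟨trivial, rfl⟩
  | succ n ih =>
    rw [take_succ]
    refine ⟨T.isPath_append ih.1 ⟨ih.2.symm, trivial⟩, ?_⟩
    rw [endpoint_append]
    exact ξ.valid n

/-- The initial segment `ξ|ₙ`, as a finite path. -/
def InfPath.initial (ξ : T.InfPath) (n : ℕ) : T.FinPath := ⟨ξ.rng, ξ.take n, (ξ.isPath_take n).1⟩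

/-- The infinite path that remains when the first `n` edges of `ξ` are deleted. -/
def InfPath.drop (ξ : T.InfPath) (n : ℕ) : T.InfPath :=
  ⟨fun k => ξ.edge (n + k), fun k => ξ.valid (n + k)⟩

theorem InfPath.length_initial (ξ : T.InfPath) (n : ℕ) : (ξ.initial n).length = n := by
  simp [initial, FinPath.length, take]

theorem InfPath.src_initial (ξ : T.InfPath) (n : ℕ) : (ξ.initial n).src = (ξ.drop n).rng :=
  (ξ.isPath_take n).2

theorem InfPath.take_add (ξ : T.InfPath) (m n : ℕ) :
    ξ.take (m + n) = ξ.take m ++ (ξ.drop m).take n := by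
  induction n with
  | zero => simp [take]
  | succ n ih => rw [← add_assoc, take_succ, ih, take_succ, List.append_assoc]; rfl

theorem InfPath.initial_prepend_drop (ξ : T.InfPath) (n : ℕ) :
    (ξ.initial n).prepend (ξ.drop n) (ξ.src_initial n) = ξ := by
  refine ext_take_add n fun k => ?_
  have h := (ξ.initial n).take_prepend (ξ.drop n) (ξ.src_initial n) k
  rw [length_initial] at h
  rw [h, take_add]
  rfl

/-- Two finite initial segments of an infinite path are comparable. -/
theorem FinPath.exists_append {α β : T.FinPath} {ξ η : T.InfPath} {h : α.src = ξ.rng}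
    {h' : β.src = η.rng} (e : α.prepend ξ h = β.prepend η h') (hl : β.length ≤ α.length) :
    ∃ (ε : T.FinPath) (k : β.src = ε.rng) (l : ε.src = ξ.rng),
      α = β.append ε k ∧ η = ε.prepend ξ l := by
  have k : β.src = (η.initial (α.length - β.length)).rng := h'
  have hα : α = β.append (η.initial (α.length - β.length)) k := by
    refine FinPath.ext ?_ ?_
    · change α.rng = β.rng
      rw [← α.rng_prepend ξ h, e, rng_prepend]
    · change α.edges = β.edges ++ η.take _
      rw [← β.take_prepend η h', ← e, Nat.add_sub_cancel' hl]
      have := α.take_prepend ξ h 0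
      simpa [InfPath.take] using this.symm
  have l : (η.initial (α.length - β.length)).src = ξ.rng := by
    rw [← h]
    conv_rhs => rw [hα, src_append]
  refine ⟨_, k, l, hα, ?_⟩
  have h2 : (β.append (η.initial (α.length - β.length)) k).src = ξ.rng := by
    rw [src_append, l]
  have e2 : (β.append (η.initial (α.length - β.length)) k).prepend ξ h2 = β.prepend η h' := by
    rw [← e]
    congr 1
    exact hα.symm
  rw [prepend_append] at e2
  exact (prepend_inj e2).symm

variable (T) in
/-- The nonzero elements `(α, g, β)` of the inverse semigroup `S_{G,E}`. -/
@[ext]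
structure Triple where
  α : T.FinPath
  g : G
  β : T.FinPath
  src_eq : α.src = g • β.src

variable (T) in
/-- The inverse semigroup `S_{G,E}`, consisting of the triples and a zero. -/
abbrev Semigp : Type _ := Option T.Triple

namespace Triple

theorem mul_aux₁ (y : T.Triple) (ε : T.FinPath) (h : y.α.src = ε.rng) :
    y.β.src = (ε.act y.g⁻¹).rng := by
  change _ = y.g⁻¹ • ε.rng
  rw [← h, y.src_eq, inv_smul_smul]

theorem mul_aux₂ (x y : T.Triple) (ε : T.FinPath) (h : y.α.src = ε.rng)
    (e : x.β = y.α.append ε h) :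
    x.α.src = (x.g * (ε.coc y.g⁻¹)⁻¹) •
      (y.β.append (ε.act y.g⁻¹) (mul_aux₁ y ε h)).src := by
  rw [FinPath.src_append, FinPath.src_act, x.src_eq, e, FinPath.src_append, mul_smul,
    ← FinPath.coc_smul y.g⁻¹ ε, inv_smul_smul]

theorem mul_aux₃ (x : T.Triple) (ε : T.FinPath) (h : x.β.src = ε.rng) :
    x.α.src = (ε.act x.g).rng := by
  change _ = x.g • ε.rng
  rw [← h, x.src_eq]

theorem mul_aux₄ (x y : T.Triple) (ε : T.FinPath) (h : x.β.src = ε.rng)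
    (e : y.α = x.β.append ε h) :
    (x.α.append (ε.act x.g) (mul_aux₃ x ε h)).src = (ε.coc x.g * y.g) • y.β.src := by
  rw [FinPath.src_append, FinPath.src_act, mul_smul, ← y.src_eq, e, FinPath.src_append,
    FinPath.coc_smul]

open scoped Classical in
/-- The product of two triples:
`(α, g, β) (γ, h, δ)` is `(α, g φ(h⁻¹, ε)⁻¹, δ (h⁻¹ε))` if `β = γε`, it is
`(α (gε), φ(g, ε) h, δ)` if `γ = βε`, and it is zero otherwise. -/
noncomputable def mul (x y : T.Triple) : T.Semigp :=
  if h : ∃ (ε : T.FinPath) (h : y.α.src = ε.rng), x.β = y.α.append ε h then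
    some ⟨x.α, x.g * (h.choose.coc y.g⁻¹)⁻¹,
      y.β.append (h.choose.act y.g⁻¹)
        (mul_aux₁ y _ h.choose_spec.choose),
      mul_aux₂ x y _ h.choose_spec.choose h.choose_spec.choose_spec⟩
  else if h : ∃ (ε : T.FinPath) (h : x.β.src = ε.rng), y.α = x.β.append ε h then
    some ⟨x.α.append (h.choose.act x.g) (mul_aux₃ x _ h.choose_spec.choose),
      h.choose.coc x.g * y.g, y.β,
      mul_aux₄ x y _ h.choose_spec.choose h.choose_spec.choose_spec⟩
  else none

theorem mul_of_left (x y : T.Triple) (ε : T.FinPath) (h : y.α.src = ε.rng)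
    (e : x.β = y.α.append ε h) :
    x.mul y = some ⟨x.α, x.g * (ε.coc y.g⁻¹)⁻¹, y.β.append (ε.act y.g⁻¹) (mul_aux₁ y ε h),
      mul_aux₂ x y ε h e⟩ := by
  have H : ∃ (ε : T.FinPath) (h : y.α.src = ε.rng), x.β = y.α.append ε h := ⟨ε, h, e⟩
  have hε : H.choose = ε :=
    FinPath.append_cancel (H.choose_spec.choose_spec.symm.trans e)
  rw [mul, dif_pos H]
  congr 2 <;> simp only [hε]

theorem mul_of_right (x y : T.Triple) (ε : T.FinPath) (h : x.β.src = ε.rng)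
    (e : y.α = x.β.append ε h) (hl : x.β.length < y.α.length) :
    x.mul y = some ⟨x.α.append (ε.act x.g) (mul_aux₃ x ε h), ε.coc x.g * y.g, y.β,
      mul_aux₄ x y ε h e⟩ := by
  have H0 : ¬ ∃ (ε : T.FinPath) (h : y.α.src = ε.rng), x.β = y.α.append ε h := by
    rintro ⟨ε', h', e'⟩
    rw [e', FinPath.length_append] at hl
    omega
  have H : ∃ (ε : T.FinPath) (h : x.β.src = ε.rng), y.α = x.β.append ε h := ⟨ε, h, e⟩
  have hε : H.choose = ε :=
    FinPath.append_cancel (H.choose_spec.choose_spec.symm.trans e)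
  rw [mul, dif_neg H0, dif_pos H]
  congr 2 <;> simp only [hε]

/-- `(α, g, β)* = (β, g⁻¹, α)`. -/
def star (x : T.Triple) : T.Triple := ⟨x.β, x.g⁻¹, x.α, by rw [x.src_eq, inv_smul_smul]⟩

/-- The element `(α, 1, β)`, where `d(α) = d(β)`. -/
def ofPair (α β : T.FinPath) (h : α.src = β.src) : T.Triple := ⟨α, 1, β, by rw [one_smul, h]⟩

end Triple

namespace Semigp

/-- The product of `S_{G,E}`. -/
noncomputable def mul : T.Semigp → T.Semigp → T.Semigp
  | some x, some y => x.mul y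
  | _, _ => none

/-- The action of `S_{G,E}` on infinite paths: `η = βξ` lies in the domain of `(α, g, β)`, which
maps it to `ζ = α (gξ)`. -/
def Maps (e : T.Semigp) (η ζ : T.InfPath) : Prop :=
  ∃ (x : T.Triple) (ξ : T.InfPath) (h : x.β.src = ξ.rng) (k : x.α.src = (ξ.act x.g).rng),
    e = some x ∧ η = x.β.prepend ξ h ∧ ζ = x.α.prepend (ξ.act x.g) k

end Semigp

variable (T) in
/-- The pairs `((α, g, β), βξ)`, which represent the germs. -/
@[ext]
structure PreGerm where
  x : T.Triple
  ξ : T.InfPath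
  src_eq : x.β.src = ξ.rng

namespace PreGerm

/-- The infinite path `βξ`. -/
def base (p : T.PreGerm) : T.InfPath := p.x.β.prepend p.ξ p.src_eq

theorem act_eq (p : T.PreGerm) : p.x.α.src = (p.ξ.act p.x.g).rng := by
  rw [InfPath.rng_act, p.x.src_eq, p.src_eq]

/-- The infinite path `α (gξ)`. -/
def target (p : T.PreGerm) : T.InfPath := p.x.α.prepend (p.ξ.act p.x.g) p.act_eq

/-- Equality of germs: `[x; η] = [y; μ]` if `η = μ` and there is an idempotent `e ≠ 0` of
`S_{G,E}` with `e η = η` and `x e = y e`. -/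
def Rel (p q : T.PreGerm) : Prop :=
  p.base = q.base ∧ ∃ e : T.Semigp, e ≠ none ∧ e.mul e = e ∧ e.Maps p.base p.base ∧
    Semigp.mul (some p.x) e = Semigp.mul (some q.x) e

/-- The value `(ρ^|α| (Φ(g, ξ)), |α| - |β|)` of the lag function on a representative. -/
def lag (p : T.PreGerm) : LagGroup G :=
  ⟨coronaAction G (Multiplicative.ofAdd (p.x.α.length : ℤ))
      (QuotientGroup.mk (p.ξ.Phi p.x.g) : Corona G),
    Multiplicative.ofAdd ((p.x.α.length : ℤ) - p.x.β.length)⟩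


theorem lag_eq_iff (p q : T.PreGerm) : p.lag = q.lag ↔
    p.x.α.length + q.x.β.length = q.x.α.length + p.x.β.length ∧
    ∃ N, ∀ n ≥ N, p.ξ.Phi p.x.g (q.x.α.length + n) = q.ξ.Phi q.x.g (p.x.α.length + n) := by
  rw [← coronaAction_eq_iff, SemidirectProduct.ext_iff, and_comm]
  refine and_congr ?_ Iff.rfl
  change Multiplicative.ofAdd _ = Multiplicative.ofAdd _ ↔ _
  rw [Multiplicative.ofAdd.injective.eq_iff]
  omega

/-- The product of germs on representatives, and its values under range, source and lag. -/
theorem exists_mul (p q : T.PreGerm) (h : p.base = q.target) :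
    ∃ w : T.PreGerm, Semigp.mul (some p.x) (some q.x) = some w.x ∧ w.base = q.base ∧
      w.target = p.target ∧ w.lag = p.lag * q.lag := by
  rcases le_or_gt q.x.α.length p.x.β.length with hl | hl
  · obtain ⟨ε, k, l, e1, e2⟩ := FinPath.exists_append h hl
    have e3 : q.ξ = (q.ξ.act q.x.g).act q.x.g⁻¹ := by
      rw [← InfPath.act_mul, inv_mul_cancel, InfPath.act_one]
    rw [e2, FinPath.act_prepend] at e3
    have hs : (q.x.β.append (ε.act q.x.g⁻¹) (Triple.mul_aux₁ q.x ε k)).src =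
        (p.ξ.act (ε.coc q.x.g⁻¹)).rng := by
      rw [FinPath.src_append, FinPath.src_act, InfPath.rng_act, FinPath.coc_smul, l]
    have ha : (p.ξ.act (ε.coc q.x.g⁻¹)).act (p.x.g * (ε.coc q.x.g⁻¹)⁻¹) = p.ξ.act p.x.g := by
      rw [← InfPath.act_mul, inv_mul_cancel_right]
    refine ⟨⟨⟨p.x.α, p.x.g * (ε.coc q.x.g⁻¹)⁻¹, _, Triple.mul_aux₂ p.x q.x ε k e1⟩,
      p.ξ.act (ε.coc q.x.g⁻¹), hs⟩, Triple.mul_of_left p.x q.x ε k e1, ?_, ?_, ?_⟩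
    · simp only [base]
      rw [FinPath.prepend_append]
      congr 1
      exact e3.symm
    · simp only [target, ha]
    · refine SemidirectProduct.ext ?_ ?_
      · rw [SemidirectProduct.mul_left]
        simp only [lag]
        rw [← MulAut.mul_apply, ← map_mul, ← ofAdd_add]
        have e4 : ((p.x.α.length : ℤ) - p.x.β.length + q.x.α.length) =
            p.x.α.length + -((ε.act q.x.g⁻¹).length : ℤ) := by
          rw [e1, FinPath.length_append, FinPath.length_act]
          push_cast
          ring
        rw [e4, ofAdd_add, map_mul, MulAut.mul_apply, coronaAction_neg, ← map_mul,
          InfPath.Phi_mul]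
        congr 1
        rw [QuotientGroup.mk_mul]
        congr 2
        · rw [← InfPath.act_mul, inv_mul_cancel, InfPath.act_one]
        · funext n
          have e5 : (ε.act q.x.g⁻¹).coc q.x.g = (ε.coc q.x.g⁻¹)⁻¹ := by
            have := ε.coc_inv_act q.x.g⁻¹
            rwa [inv_inv] at this
          conv_rhs => rw [e3]
          rw [FinPath.Phi_prepend, e5]
      · rw [SemidirectProduct.mul_right]
        simp only [lag]
        rw [← ofAdd_add]
        congr 1
        rw [FinPath.length_append, FinPath.length_act, e1, FinPath.length_append]
        push_cast
        ring
  · obtain ⟨ε, k, l, e1, e2⟩ := FinPath.exists_append h.symm hl.le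
    have ha : (p.x.α.append (ε.act p.x.g) (Triple.mul_aux₃ p.x ε k)).src =
        (q.ξ.act (ε.coc p.x.g * q.x.g)).rng := by
      rw [FinPath.src_append, FinPath.src_act, InfPath.rng_act, mul_smul, FinPath.coc_smul,
        ← InfPath.rng_act, l]
    refine ⟨⟨⟨_, ε.coc p.x.g * q.x.g, q.x.β, Triple.mul_aux₄ p.x q.x ε k e1⟩, q.ξ, q.src_eq⟩,
      Triple.mul_of_right p.x q.x ε k e1 hl, rfl, ?_, ?_⟩
    · simp only [target]
      rw [FinPath.prepend_append]
      congr 1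
      rw [e2, FinPath.act_prepend]
      congr 1
      rw [InfPath.act_mul]
    · refine SemidirectProduct.ext ?_ ?_
      · rw [SemidirectProduct.mul_left]
        simp only [lag]
        rw [← MulAut.mul_apply, ← map_mul, ← ofAdd_add]
        have e4 : ((p.x.α.length : ℤ) - p.x.β.length + q.x.α.length) =
            ((p.x.α.append (ε.act p.x.g) (Triple.mul_aux₃ p.x ε k)).length : ℤ) := by
          rw [e1, FinPath.length_append, FinPath.length_append, FinPath.length_act]
          push_cast
          ring
        rw [e4, InfPath.Phi_mul, QuotientGroup.mk_mul, map_mul]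
        congr 1
        refine (coronaAction_eq_iff _ _ _ _).2 ⟨0, fun n _ => ?_⟩
        rw [FinPath.length_append, FinPath.length_act, e2, add_comm p.x.α.length ε.length,
          add_assoc, FinPath.Phi_prepend]
      · rw [SemidirectProduct.mul_right]
        simp only [lag]
        rw [← ofAdd_add]
        congr 1
        rw [FinPath.length_append, FinPath.length_act, e1, FinPath.length_append]
        push_cast
        ring

theorem mul_idem (p : T.PreGerm) (m : ℕ) (hm : 0 < m) :
    ∃ t : T.Triple,
      Semigp.mul (some p.x) (some (Triple.ofPair (p.base.initial (p.x.β.length + m))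
        (p.base.initial (p.x.β.length + m)) rfl)) = some t ∧
      t.β = p.base.initial (p.x.β.length + m) ∧ t.g = p.ξ.Phi p.x.g m ∧
      t.α = p.target.initial (p.x.α.length + m) := by
  have h := p.base.initial_prepend_drop (p.x.β.length + m)
  have hl : p.x.β.length < (p.base.initial (p.x.β.length + m)).length := by
    rw [InfPath.length_initial]
    omega
  obtain ⟨ε, k, l, e1, e2⟩ := FinPath.exists_append (h' := p.src_eq) h hl.le
  have hε : ε.length = m := by
    have := congrArg FinPath.length e1
    rw [InfPath.length_initial, FinPath.length_append] at this
    omega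
  have hε' : ε.edges = p.ξ.take m := by
    have := FinPath.take_prepend ε _ l 0
    rw [← e2, hε] at this
    simpa [InfPath.take] using this.symm
  refine ⟨_, Triple.mul_of_right p.x _ ε k e1 hl, rfl, ?_, ?_⟩
  · simp [Triple.ofPair, FinPath.coc, InfPath.Phi, hε']
  · refine FinPath.ext (FinPath.rng_prepend p.x.α _ p.act_eq).symm ?_
    change p.x.α.edges ++ T.actList p.x.g ε.edges = p.target.take _
    rw [target, FinPath.take_prepend, InfPath.take_act, hε']

theorem ext_base (p q : T.PreGerm) (hx : p.x = q.x) (h : p.base = q.base) : p = q := by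
  obtain ⟨x, ξ, h1⟩ := p
  obtain ⟨y, η, h2⟩ := q
  obtain rfl : x = y := hx
  obtain rfl : ξ = η := FinPath.prepend_inj h
  rfl

/-- A germ is determined by its source, its range and its lag. -/
theorem rel_iff (p q : T.PreGerm) :
    p.Rel q ↔ p.base = q.base ∧ p.target = q.target ∧ p.lag = q.lag := by
  refine and_congr_right fun hb => ⟨?_, ?_⟩
  · rintro ⟨e, -, -, ⟨x, ξ, h, k, rfl, h1, h2⟩, h3⟩
    obtain ⟨w, hw1, hw2, hw3, hw4⟩ := exists_mul p ⟨x, ξ, h⟩ h2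
    obtain ⟨w', hw1', hw2', hw3', hw4'⟩ := exists_mul q ⟨x, ξ, h⟩ (hb.symm.trans h2)
    have e1 : w = w' := by
      refine ext_base _ _ ?_ (hw2.trans hw2'.symm)
      have h4 : some w.x = some w'.x := hw1.symm.trans (h3.trans hw1')
      exact Option.some.inj h4
    subst e1
    exact ⟨hw3.symm.trans hw3', mul_right_cancel (hw4.symm.trans hw4')⟩
  · rintro ⟨ht, hlag⟩
    obtain ⟨hlen, N, hN⟩ := (lag_eq_iff p q).1 hlag
    obtain ⟨t, ht1, ht2, ht3, ht4⟩ := mul_idem p (q.x.α.length + N + 1) (by omega)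
    obtain ⟨t', ht1', ht2', ht3', ht4'⟩ := mul_idem q (p.x.α.length + N + 1) (by omega)
    have hL : q.x.β.length + (p.x.α.length + N + 1) =
        p.x.β.length + (q.x.α.length + N + 1) := by omega
    have htt : t = t' := by
      refine Triple.ext ?_ ?_ ?_
      · rw [ht4, ht4', ht]
        congr 1
        omega
      · rw [ht3, ht3', add_assoc, add_assoc, hN (N + 1) (by omega)]
      · rw [ht2, ht2', hb, hL]
    rw [hL, ← hb] at ht1'
    set τ := p.base.initial (p.x.β.length + (q.x.α.length + N + 1)) with hτ
    refine ⟨some (Triple.ofPair τ τ rfl), by simp, ?_, ?_, ?_⟩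
    · have h0 : τ.src = (FinPath.ofVertex (T := T) τ.src).rng := rfl
      have h1 : τ = τ.append (FinPath.ofVertex τ.src) h0 :=
        FinPath.ext rfl (List.append_nil _).symm
      refine (Triple.mul_of_left (Triple.ofPair τ τ rfl) (Triple.ofPair τ τ rfl) _ h0 h1).trans ?_
      congr 1
      refine Triple.ext rfl ?_ ?_
      · simp [Triple.ofPair, FinPath.coc_one]
      · exact FinPath.ext rfl (List.append_nil _)
    · refine ⟨Triple.ofPair τ τ rfl, p.base.drop _, InfPath.src_initial _ _, ?_, rfl, ?_, ?_⟩
      · simp only [Triple.ofPair, InfPath.act_one]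
        exact InfPath.src_initial _ _
      · exact (InfPath.initial_prepend_drop _ _).symm
      · simp only [Triple.ofPair, InfPath.act_one]
        exact (InfPath.initial_prepend_drop _ _).symm
    · rw [ht1, ht1', htt]

/-- The representative `(x*, x (βξ))` of the inverse germ. -/
def inv (p : T.PreGerm) : T.PreGerm := ⟨p.x.star, p.ξ.act p.x.g, p.act_eq⟩

theorem target_inv (p : T.PreGerm) : p.inv.target = p.base := by
  simp only [target, base, inv, Triple.star]
  congr 1
  rw [← InfPath.act_mul, inv_mul_cancel, InfPath.act_one]

theorem lag_inv (p : T.PreGerm) : p.inv.lag = p.lag⁻¹ := by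
  refine eq_inv_of_mul_eq_one_left ?_
  refine SemidirectProduct.ext ?_ ?_
  · rw [SemidirectProduct.mul_left]
    simp only [lag, inv, Triple.star]
    rw [← MulAut.mul_apply, ← map_mul, ← ofAdd_add, sub_add_cancel, ← map_mul,
      ← QuotientGroup.mk_mul, ← InfPath.Phi_mul, inv_mul_cancel, InfPath.Phi_one,
      QuotientGroup.mk_one, map_one]
    rfl
  · rw [SemidirectProduct.mul_right]
    simp only [lag, inv, Triple.star]
    rw [← ofAdd_add, sub_add_sub_cancel, sub_self]
    rfl

/-- The representative `(v, 1, v; η)` of the unit at the infinite path `η`, with `v` the range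
of `η`. -/
def unit (η : T.InfPath) : T.PreGerm :=
  ⟨Triple.ofPair (FinPath.ofVertex η.rng) (FinPath.ofVertex η.rng) rfl, η, rfl⟩

theorem base_unit (η : T.InfPath) : (unit η).base = η := by
  ext n
  simp [unit, base, Triple.ofPair, FinPath.ofVertex, FinPath.prepend, FinPath.length]

theorem target_unit (η : T.InfPath) : (unit η).target = η := by
  ext n
  simp [unit, target, Triple.ofPair, FinPath.ofVertex, FinPath.prepend, FinPath.length,
    InfPath.act_one]

theorem lag_unit (η : T.InfPath) : (unit η).lag = 1 := by
  refine SemidirectProduct.ext ?_ ?_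
  · simp only [lag, unit, Triple.ofPair]
    rw [InfPath.Phi_one, QuotientGroup.mk_one, map_one]
    rfl
  · simp only [lag, unit, Triple.ofPair, sub_self]
    rfl

variable (T) in
/-- Equality of germs is an equivalence relation on the representatives. -/
def setoid : Setoid T.PreGerm where
  r := Rel
  iseqv :=
    { refl := fun p => (rel_iff p p).2 ⟨rfl, rfl, rfl⟩
      symm := fun {p q} h => by
        obtain ⟨h1, h2, h3⟩ := (rel_iff p q).1 h
        exact (rel_iff q p).2 ⟨h1.symm, h2.symm, h3.symm⟩
      trans := fun {p q w} h k => by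
        obtain ⟨h1, h2, h3⟩ := (rel_iff p q).1 h
        obtain ⟨k1, k2, k3⟩ := (rel_iff q w).1 k
        exact (rel_iff p w).2 ⟨h1.trans k1, h2.trans k2, h3.trans k3⟩ }

end PreGerm

variable (T) in
/-- The groupoid of germs `𝒢_(G,E)`, as a set. -/
def Germ : Type _ := Quotient (PreGerm.setoid T)

namespace Germ

/-- The germ `[α, g, β; βξ]` of a representative. -/
def mk (p : T.PreGerm) : T.Germ := Quotient.mk _ p

theorem mk_eq_mk {p q : T.PreGerm} : mk p = mk q ↔ p.Rel q := Quotient.eq (r := PreGerm.setoid T)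

/-- The source `βξ` of `[α, g, β; βξ]`, as an infinite path. -/
def srcPath : T.Germ → T.InfPath :=
  Quotient.lift PreGerm.base fun p q h => ((PreGerm.rel_iff p q).1 h).1

/-- The range `α (gξ)` of `[α, g, β; βξ]`, as an infinite path. -/
def rngPath : T.Germ → T.InfPath :=
  Quotient.lift PreGerm.target fun p q h => ((PreGerm.rel_iff p q).1 h).2.1

/-- The lag function `[α, g, β; βξ] ↦ (ρ^|α| (Φ(g, ξ)), |α| - |β|)`. -/
def lagFun : T.Germ → LagGroup G :=
  Quotient.lift PreGerm.lag fun p q h => ((PreGerm.rel_iff p q).1 h).2.2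

theorem ext' {γ δ : T.Germ} (h1 : γ.srcPath = δ.srcPath) (h2 : γ.rngPath = δ.rngPath)
    (h3 : γ.lagFun = δ.lagFun) : γ = δ := by
  induction γ using Quotient.ind with
  | _ p =>
    induction δ using Quotient.ind with
    | _ q => exact mk_eq_mk.2 ((PreGerm.rel_iff p q).2 ⟨h1, h2, h3⟩)

/-- The unit at an infinite path. -/
def unit (η : T.InfPath) : T.Germ := mk (PreGerm.unit η)

/-- The inverse, `[x; η]⁻¹ = [x*; xη]`. -/
def inv : T.Germ → T.Germ :=
  Quotient.lift (fun p => mk p.inv) fun p q h => by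
    obtain ⟨h1, h2, h3⟩ := (PreGerm.rel_iff p q).1 h
    refine mk_eq_mk.2 ((PreGerm.rel_iff _ _).2 ⟨h2, ?_, ?_⟩)
    · rw [PreGerm.target_inv, PreGerm.target_inv, h1]
    · rw [PreGerm.lag_inv, PreGerm.lag_inv, h3]

/-- The pair `γ`, `δ` has representatives `γ = [x; yη]`, `δ = [y; η]`, and `w` represents
`[xy; η]`. -/
def IsMul (γ δ : T.Germ) (w : T.PreGerm) : Prop :=
  ∃ p q : T.PreGerm, mk p = γ ∧ mk q = δ ∧ p.base = q.target ∧
    Semigp.mul (some p.x) (some q.x) = some w.x ∧ w.base = q.base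

open scoped Classical in
/-- The product of composable germs, `[x; yη] [y; η] = [xy; η]`. -/
noncomputable def mul (γ δ : T.Germ) : T.Germ :=
  if h : ∃ w, IsMul γ δ w then mk h.choose else γ

theorem IsMul.spec {γ δ : T.Germ} {w : T.PreGerm} (h : IsMul γ δ w) :
    (mk w).srcPath = δ.srcPath ∧ (mk w).rngPath = γ.rngPath ∧
      (mk w).lagFun = γ.lagFun * δ.lagFun := by
  obtain ⟨p, q, rfl, rfl, h1, h2, h3⟩ := h
  obtain ⟨w', k1, k2, k3, k4⟩ := PreGerm.exists_mul p q h1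
  have e : w = w' :=
    PreGerm.ext_base _ _ (Option.some.inj (h2.symm.trans k1)) (h3.trans k2.symm)
  subst e
  exact ⟨k2, k3, k4⟩

/-- The product does not depend on the representatives. -/
theorem IsMul.mul_eq {γ δ : T.Germ} {w : T.PreGerm} (h : IsMul γ δ w) : mul γ δ = mk w := by
  have H : ∃ w, IsMul γ δ w := ⟨w, h⟩
  rw [mul, dif_pos H]
  obtain ⟨a1, a2, a3⟩ := H.choose_spec.spec
  obtain ⟨b1, b2, b3⟩ := h.spec
  exact ext' (a1.trans b1.symm) (a2.trans b2.symm) (a3.trans b3.symm)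

theorem mul_spec {γ δ : T.Germ} (h : γ.srcPath = δ.rngPath) :
    (mul γ δ).srcPath = δ.srcPath ∧ (mul γ δ).rngPath = γ.rngPath ∧
      (mul γ δ).lagFun = γ.lagFun * δ.lagFun := by
  induction γ using Quotient.ind with
  | _ p =>
    induction δ using Quotient.ind with
    | _ q =>
      obtain ⟨w, k1, k2, k3, k4⟩ := PreGerm.exists_mul p q h
      have H : IsMul (mk p) (mk q) w := ⟨p, q, rfl, rfl, h, k1, k2⟩
      have e := H.mul_eq
      have := H.spec
      rw [← e] at this
      exact this

theorem srcPath_unit (η : T.InfPath) : (unit η).srcPath = η := PreGerm.base_unit η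

theorem rngPath_unit (η : T.InfPath) : (unit η).rngPath = η := PreGerm.target_unit η

theorem lagFun_unit (η : T.InfPath) : (unit η).lagFun = 1 := PreGerm.lag_unit η

theorem srcPath_inv (γ : T.Germ) : (inv γ).srcPath = γ.rngPath := by
  induction γ using Quotient.ind with
  | _ p => rfl

theorem rngPath_inv (γ : T.Germ) : (inv γ).rngPath = γ.srcPath := by
  induction γ using Quotient.ind with
  | _ p => exact p.target_inv

theorem lagFun_inv (γ : T.Germ) : (inv γ).lagFun = γ.lagFun⁻¹ := by
  induction γ using Quotient.ind with
  | _ p => exact p.lag_inv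

theorem unit_inj {η ζ : T.InfPath} (h : unit η = unit ζ) : η = ζ := by
  rw [← srcPath_unit η, h, srcPath_unit]

/-- The groupoid structure of `𝒢_(G,E)`. -/
noncomputable instance : ArrowGroupoid T.Germ where
  r γ := unit γ.rngPath
  s γ := unit γ.srcPath
  mul := mul
  inv := inv
  s_r γ := by rw [srcPath_unit]
  r_s γ := by rw [rngPath_unit]
  r_mul γ δ h := by rw [(mul_spec (unit_inj h)).2.1]
  s_mul γ δ h := by rw [(mul_spec (unit_inj h)).1]
  mul_assoc γ δ ε h k := by
    have h' := unit_inj h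
    have k' := unit_inj k
    obtain ⟨a1, a2, a3⟩ := mul_spec h'
    obtain ⟨b1, b2, b3⟩ := mul_spec k'
    obtain ⟨c1, c2, c3⟩ := mul_spec (a1.trans k')
    obtain ⟨d1, d2, d3⟩ := mul_spec (h'.trans b2.symm)
    exact ext' (by rw [c1, d1, b1]) (by rw [c2, d2, a2]) (by rw [c3, d3, a3, b3, _root_.mul_assoc])
  r_mul_self γ := by
    obtain ⟨a1, a2, a3⟩ := mul_spec (srcPath_unit γ.rngPath)
    exact ext' a1 (a2.trans (rngPath_unit _)) (by rw [a3, lagFun_unit, one_mul])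
  mul_s_self γ := by
    obtain ⟨a1, a2, a3⟩ := mul_spec (rngPath_unit γ.srcPath).symm
    exact ext' (a1.trans (srcPath_unit _)) a2 (by rw [a3, lagFun_unit, mul_one])
  r_inv γ := by rw [rngPath_inv]
  s_inv γ := by rw [srcPath_inv]
  mul_inv γ := by
    obtain ⟨a1, a2, a3⟩ := mul_spec (rngPath_inv γ).symm
    refine ext' ?_ ?_ ?_
    · rw [a1, srcPath_inv, srcPath_unit]
    · rw [a2, rngPath_unit]
    · rw [a3, lagFun_inv, lagFun_unit, mul_inv_cancel]
  inv_mul γ := by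
    obtain ⟨a1, a2, a3⟩ := mul_spec (srcPath_inv γ)
    refine ext' ?_ ?_ ?_
    · rw [a1, srcPath_unit]
    · rw [a2, rngPath_inv, rngPath_unit]
    · rw [a3, lagFun_inv, lagFun_unit, inv_mul_cancel]

/-- The cylinder `Z(δ)` of all infinite paths `δη`. -/
def cylinder (δ : T.FinPath) : Set T.InfPath :=
  {ζ | ∃ (η : T.InfPath) (h : δ.src = η.rng), ζ = δ.prepend η h}

/-- The set `Θ(α, g, β; Z(δ))` of all germs `[α, g, β; ζ]` with `ζ ∈ Z(δ)`. -/
def Theta (x : T.Triple) (δ : T.FinPath) : Set T.Germ :=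
  {γ | ∃ (ξ : T.InfPath) (h : x.β.src = ξ.rng),
    x.β.prepend ξ h ∈ cylinder δ ∧ γ = mk ⟨x, ξ, h⟩}

/-- The topology of `𝒢_(G,E)`, generated by the sets `Θ(α, g, β; Z(δ))`. -/
instance : TopologicalSpace T.Germ :=
  TopologicalSpace.generateFrom {W | ∃ (x : T.Triple) (δ : T.FinPath), W = Theta x δ}

end Germ

variable (T) in
/-- The lag function, as a cocycle on `𝒢_(G,E)` with values in the lag group. -/
def lagCocycle : ArrowGroupoid.Cocycle T.Germ (LagGroup G) where
  toFun := Germ.lagFun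
  map_mul _ _ h := (Germ.mul_spec (Germ.unit_inj h)).2.2

end

end GraphTriple

/-! A germ is determined by its source, its range and its lag (`PreGerm.rel_iff`), and this carries
the statements about the kernel. A germ of trivial lag with equal source and range has the same
three invariants as the unit at its source, so it is that unit, and the kernel is principal. For the
description of the kernel, trivial lag means that $|\alpha|=|\beta|$ and that $\varphi(g,\xi|_n)=1$
for all large $n$. Lengthening the representative along $\xi|_n$ does not change the germ
(`mk_extend`) and replaces $g$ by $\varphi(g,\xi|_n)=1$. Strong effectiveness follows because a
principal groupoid with open unit space keeps both properties under restriction.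

Ampleness rests on a good basis. Two triples with a common germ have a common extension
(`exists_extend_eq`), so the sets `bisection x` form a basis. The range map is injective and open on
each of them, and products of matching bisections are again controlled by triples. The unit space is
a closed subspace of $E^{\mathbb N}$ (`isClosedEmbedding_units`), hence compact and totally
disconnected when $E$ is finite.

The ideal correspondence is proved for any ample groupoid with a locally constant cocycle of
principal kernel. Let $J$ be a graded ideal and $U$ the set of units at which some element of $J$ is
nonzero. Translating by bisections shows that $U$ is invariant and that elements of $J$ live over
$U$. Conversely, if $f\in J$ and $f(u)\neq0$, the component of degree $1$ of $f$ also lies in $J$,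
and by principality its support meets the isotropy only in units. Cutting it down on both sides by a
small compact open $W\ni u$ leaves $f(u)1_W$, so $1_W\in J$ (`exists_indicator_one_mem`). Finitely
many such $W$ give a local unit for any function over $U$, whence $J=A_K(\mathcal G|_U)$
(`IsGradedIdeal.eq_steinbergOn`). -/

namespace ArrowGroupoid

/-! ### Cancellation in groupoids and evaluation of convolutions -/

section Algebraic

variable {𝒢 : Type*} [ArrowGroupoid 𝒢]

theorem inv_inv (γ : 𝒢) : inv (inv γ) = γ := by
  have h1 : s (inv (inv γ)) = r (inv γ) := s_inv _
  have h2 : s (inv γ) = r γ := s_inv _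
  have h := mul_assoc (inv (inv γ)) (inv γ) γ h1 h2
  rwa [inv_mul, inv_mul, h2, r_mul_self, ← r_inv γ, ← s_inv (inv γ), mul_s_self, eq_comm] at h

theorem eq_inv_mul {α β γ : 𝒢} (h : s α = r β) (e : mul α β = γ) : β = mul (inv α) γ := by
  rw [← e, ← mul_assoc _ _ _ (s_inv α) h, inv_mul, h, r_mul_self]

theorem mul_inv_mul {α γ : 𝒢} (h : r α = r γ) : mul α (mul (inv α) γ) = γ := by
  rw [← mul_assoc _ _ _ (r_inv α).symm ((s_inv α).trans h), mul_inv, h, r_mul_self]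

theorem s_eq_r_inv_mul {α γ : 𝒢} (h : r α = r γ) : s α = r (mul (inv α) γ) := by
  rw [r_mul _ _ ((s_inv α).trans h), r_inv]

theorem s_of_mem_units {u : 𝒢} (h : u ∈ units 𝒢) : s u = u := by
  have h' : r u = u := h
  rw [← h', s_r]

theorem mul_of_mem_units_right {α β : 𝒢} (hβ : β ∈ units 𝒢) (h : s α = r β) : mul α β = α := by
  have h' : r β = β := hβ
  rw [h'] at h
  rw [← h, mul_s_self]

theorem units_sub (H : Sub 𝒢) : units H.carrier = Subtype.val ⁻¹' units 𝒢 := by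
  ext γ
  exact Subtype.ext_iff

variable {K : Type*} [Field K]

/-- By cancellation a factorisation of `γ` is determined by its left factor, so it is enough to
exclude other left factors. Nearly every convolution below is computed in this way. -/
theorem conv_eq_single {f g : 𝒢 → K} {α β γ : 𝒢} (h : s α = r β) (e : mul α β = γ)
    (H : ∀ α' β', s α' = r β' → mul α' β' = γ → f α' ≠ 0 → g β' ≠ 0 → α' = α) :
    conv f g γ = f α * g β := by
  refine finsum_eq_single _ (⟨(α, β), h, e⟩ : {p : 𝒢 × 𝒢 // s p.1 = r p.2 ∧ mul p.1 p.2 = γ}) ?_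
  rintro ⟨⟨α', β'⟩, h', e'⟩ hne
  by_contra h0
  have h1 : α' = α := H α' β' h' e' (left_ne_zero_of_mul h0) (right_ne_zero_of_mul h0)
  subst h1
  exact hne (Subtype.ext (Prod.ext rfl ((eq_inv_mul h' e').trans (eq_inv_mul h e).symm)))

theorem exists_of_conv_ne_zero {f g : 𝒢 → K} {γ : 𝒢} (h : conv f g γ ≠ 0) :
    ∃ α β, s α = r β ∧ mul α β = γ ∧ f α ≠ 0 ∧ g β ≠ 0 := by
  obtain ⟨⟨⟨α, β⟩, h1, h2⟩, h3⟩ := not_forall.1 (mt finsum_eq_zero_of_forall_eq_zero h)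
  exact ⟨α, β, h1, h2, left_ne_zero_of_mul h3, right_ne_zero_of_mul h3⟩

theorem conv_zero_left (g : 𝒢 → K) : conv 0 g = 0 := by
  funext γ
  by_contra h
  obtain ⟨α, β, -, -, h1, -⟩ := exists_of_conv_ne_zero h
  exact h1 rfl

/-- `finsum` is additive only for finite supports. The left factor embeds the factorisations of `γ`
into the fibre of `r` over `r γ`, where `f` and `f'` have finite support. -/
theorem conv_add_left {f f' : 𝒢 → K} (g : 𝒢 → K)
    (hf : ∀ u, {α | r α = u ∧ f α ≠ 0}.Finite) (hf' : ∀ u, {α | r α = u ∧ f' α ≠ 0}.Finite) :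
    conv (f + f') g = conv f g + conv f' g := by
  have key : ∀ f : 𝒢 → K, (∀ u, {α | r α = u ∧ f α ≠ 0}.Finite) → ∀ γ,
      (Function.support fun p : {p : 𝒢 × 𝒢 // s p.1 = r p.2 ∧ mul p.1 p.2 = γ} =>
        f p.1.1 * g p.1.2).Finite := by
    intro f hf γ
    have hinj : Function.Injective
        fun p : {p : 𝒢 × 𝒢 // s p.1 = r p.2 ∧ mul p.1 p.2 = γ} => p.1.1 := by
      rintro ⟨⟨α, β⟩, h, e⟩ ⟨⟨α', β'⟩, h', e'⟩ (rfl : α = α')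
      exact Subtype.ext (Prod.ext rfl ((eq_inv_mul h e).trans (eq_inv_mul h' e').symm))
    refine ((hf (r γ)).preimage hinj.injOn).subset ?_
    rintro ⟨⟨α, β⟩, h, e⟩ h0
    exact ⟨(r_mul _ _ h).symm.trans (congrArg r e), left_ne_zero_of_mul h0⟩
  funext γ
  have := finsum_add_distrib (key f hf γ) (key f' hf' γ)
  simp only [conv, Pi.add_apply]
  rw [← this]
  exact finsum_congr fun p => add_mul _ _ _

/-- Convolution from the left with a function supported on units. -/
theorem conv_of_units_left {f : 𝒢 → K} (hf : ∀ γ ∉ units 𝒢, f γ = 0) (g : 𝒢 → K) (γ : 𝒢) :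
    conv f g γ = f (r γ) * g γ := by
  refine conv_eq_single (s_r γ) (r_mul_self γ) fun α β h e hα _ => ?_
  have hu : α ∈ units 𝒢 := by_contra fun h => hα (hf _ h)
  rw [← e, r_mul _ _ h]
  exact hu.symm

/-- Convolution from the right with a function supported on units. -/
theorem conv_of_units_right {g : 𝒢 → K} (hg : ∀ γ ∉ units 𝒢, g γ = 0) (f : 𝒢 → K) (γ : 𝒢) :
    conv f g γ = f γ * g (s γ) := by
  refine conv_eq_single (r_s γ).symm (mul_s_self γ) fun α β h e _ hβ => ?_
  have hu : β ∈ units 𝒢 := by_contra fun h => hβ (hg _ h)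
  rw [← e, mul_of_mem_units_right hu h]

theorem indicator_one_apply_units {W : Set 𝒢} (hW : W ⊆ units 𝒢) :
    ∀ γ ∉ units 𝒢, W.indicator (1 : 𝒢 → K) γ = 0 :=
  fun _ hγ => Set.indicator_of_notMem (fun h => hγ (hW h)) _

end Algebraic

/-! ### Characteristic functions and restrictions in the Steinberg algebra -/

section Steinberg

variable {K : Type*} [Field K] {𝒢 : Type*} [TopologicalSpace 𝒢]

theorem indicator_mem_steinberg {f : 𝒢 → K} (hf : f ∈ steinberg K 𝒢) {S : Set 𝒢}
    (hS : IsClopen S) : S.indicator f ∈ steinberg K 𝒢 := by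
  have hl : IsLocallyConstant (S.indicator f) := by
    refine (IsLocallyConstant.iff_eventually_eq _).2 fun x => ?_
    by_cases hx : x ∈ S
    · filter_upwards [hS.isOpen.mem_nhds hx, (IsLocallyConstant.iff_eventually_eq _).1 hf.1 x]
        with y hy h
      simp [hx, hy, h]
    · filter_upwards [hS.compl.isOpen.mem_nhds hx] with y hy
      rw [Set.indicator_of_notMem hx, Set.indicator_of_notMem hy]
  refine ⟨hl, hf.2.of_isClosed_subset (hl.isClopen_fiber 0).compl.isClosed ?_⟩
  exact fun x hx => (Set.indicator_apply_ne_zero.1 hx).2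

theorem indicator_one_mem_steinberg [T2Space 𝒢] {S : Set 𝒢} (hS : IsOpen S) (hS' : IsCompact S) :
    S.indicator (1 : 𝒢 → K) ∈ steinberg K 𝒢 := by
  have hl : IsLocallyConstant (S.indicator (1 : 𝒢 → K)) := by
    refine (IsLocallyConstant.iff_eventually_eq _).2 fun x => ?_
    by_cases hx : x ∈ S
    · filter_upwards [hS.mem_nhds hx] with y hy
      simp [hx, hy]
    · filter_upwards [hS'.isClosed.isOpen_compl.mem_nhds hx] with y hy
      rw [Set.indicator_of_notMem hx, Set.indicator_of_notMem hy]
  refine ⟨hl, hS'.of_isClosed_subset (hl.isClopen_fiber 0).compl.isClosed ?_⟩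
  exact fun x hx => (Set.indicator_apply_ne_zero.1 hx).1

theorem steinbergOn_mono {W W' : Set 𝒢} (h : W ⊆ W') : steinbergOn K 𝒢 W ≤ steinbergOn K 𝒢 W' :=
  fun _ hf => ⟨hf.1, fun γ hγ => hf.2 γ fun h' => hγ (h h')⟩

end Steinberg

/-! ### Compact open bisections; the Steinberg algebra is closed under convolution -/

namespace IsAmple

variable {𝒢 : Type*} [TopologicalSpace 𝒢] [ArrowGroupoid 𝒢]

theorem continuous_r (h : IsAmple 𝒢) : Continuous (r : 𝒢 → 𝒢) :=
  continuous_subtype_val.comp h.isLocalHomeomorph_rng.continuous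

theorem continuous_s (h : IsAmple 𝒢) : Continuous (s : 𝒢 → 𝒢) := by
  have : (s : 𝒢 → 𝒢) = r ∘ inv := funext fun γ => (r_inv γ).symm
  rw [this]
  exact h.continuous_r.comp h.continuous_inv

/-- For `γ` close to a unit, both `γ` and `r γ` lie in one set on which the range map is injective.
They have the same range, so `γ = r γ`. -/
theorem isOpen_units (h : IsAmple 𝒢) : IsOpen (units 𝒢) := by
  refine isOpen_iff_mem_nhds.2 fun u hu => ?_
  obtain ⟨e, he, hr⟩ := h.isLocalHomeomorph_rng u
  have hu' : r u = u := hu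
  have h1 := e.open_source.mem_nhds he
  have h2 : r ⁻¹' e.source ∈ 𝓝 u :=
    h.continuous_r.continuousAt.preimage_mem_nhds (by rw [hu']; exact h1)
  filter_upwards [h1, h2] with γ k1 k2
  refine e.injOn k2 k1 ?_
  rw [← hr]
  exact Subtype.ext (r_r γ)

theorem exists_compact_open_units (h : IsAmple 𝒢) {u : units 𝒢} {O : Set (units 𝒢)}
    (hO : IsOpen O) (hu : u ∈ O) : ∃ W, IsOpen W ∧ IsCompact W ∧ u ∈ W ∧ W ⊆ O := by
  have := h.locallyCompact_units
  obtain ⟨C, hC, hCO, hCc⟩ := local_compact_nhds (hO.mem_nhds hu)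
  obtain ⟨W, hW, huW, hWC⟩ := h.zeroDimensional_units.mem_nhds_iff.1 hC
  exact ⟨W, IsClopen.isOpen hW, hCc.of_isClosed_subset (IsClopen.isClosed hW) hWC, huW,
    hWC.trans hCO⟩

/-- The compact open sets on which the range map is injective form a basis. -/
theorem exists_section (h : IsAmple 𝒢) {γ : 𝒢} {O : Set 𝒢} (hO : IsOpen O) (hγ : γ ∈ O) :
    ∃ B, IsOpen B ∧ IsCompact B ∧ γ ∈ B ∧ B ⊆ O ∧ Set.InjOn r B := by
  obtain ⟨e, he, hr⟩ := h.isLocalHomeomorph_rng γ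
  have hO' : IsOpen (e.source ∩ O) := e.open_source.inter hO
  obtain ⟨W, hW, hWc, hγW, hWO⟩ := h.exists_compact_open_units
    (e.isOpen_image_of_subset_source hO' Set.inter_subset_left) (Set.mem_image_of_mem e ⟨he, hγ⟩)
  have hWt : W ⊆ e.target := fun w hw => by
    obtain ⟨x, hx, rfl⟩ := hWO hw
    exact e.map_source hx.1
  have hB : e.symm '' W ⊆ e.source ∩ O := by
    rintro _ ⟨w, hw, rfl⟩
    obtain ⟨x, hx, rfl⟩ := hWO hw
    rwa [e.left_inv hx.1]
  refine ⟨e.symm '' W, e.symm.isOpen_image_of_subset_source hW hWt,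
    hWc.image_of_continuousOn (e.symm.continuousOn.mono hWt), ⟨e γ, hγW, e.left_inv he⟩,
    hB.trans Set.inter_subset_right, fun x hx y hy hxy => ?_⟩
  refine e.injOn (hB hx).1 (hB hy).1 ?_
  rw [← hr]
  exact Subtype.ext hxy

/-- Continuity of the product, freed from the subtype of composable pairs so that it can be combined
with limits in `𝒢 × 𝒢`. -/
theorem eventually_mul_mem (h : IsAmple 𝒢) {α β : 𝒢} (hc : s α = r β) {O : Set 𝒢}
    (hO : IsOpen O) (hm : mul α β ∈ O) :
    ∀ᶠ p : 𝒢 × 𝒢 in 𝓝 (α, β), s p.1 = r p.2 → mul p.1 p.2 ∈ O := by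
  obtain ⟨W, hW, e⟩ := isOpen_induced_iff.1 (hO.preimage h.continuous_mul)
  have key : ∀ p (hp : s p.1 = r p.2), p ∈ W ↔ mul p.1 p.2 ∈ O := fun p hp =>
    Set.ext_iff.1 e ⟨p, hp⟩
  filter_upwards [hW.mem_nhds ((key (α, β) hc).2 hm)] with p hp hp'
  exact (key p hp').1 hp

variable {K : Type*} [Field K]

/-- Every element of the Steinberg algebra is a finite sum of elements whose supports are
mapped injectively by the range map. -/
theorem steinberg_induction (h : IsAmple 𝒢) {P : (𝒢 → K) → Prop} (zero : P 0)
    (add : ∀ f ∈ steinberg K 𝒢, ∀ g ∈ steinberg K 𝒢, P f → P g → P (f + g))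
    (inj : ∀ f ∈ steinberg K 𝒢, Set.InjOn r (Function.support f) → P f)
    {f : 𝒢 → K} (hf : f ∈ steinberg K 𝒢) : P f := by
  classical
  have := h.hausdorff
  choose B hBo hBc hB _ hBi using fun γ : 𝒢 => h.exists_section isOpen_univ (Set.mem_univ γ)
  obtain ⟨t, ht⟩ := hf.2.elim_finite_subcover B hBo fun γ _ => Set.mem_iUnion.2 ⟨γ, hB γ⟩
  induction t using Finset.induction_on generalizing f with
  | empty =>
    have : f = 0 := by
      funext γ
      by_contra hγ
      simpa using ht hγ
    exact this ▸ zero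
  -- Split `f` along the clopen set `B i`: the part on `B i` has injective range map, the rest is
  -- supported in the sets indexed by `t`.
  | insert i t _ ih =>
    have hcl : IsClopen (B i) := ⟨(hBc i).isClosed, hBo i⟩
    rw [← Set.indicator_self_add_compl (B i) f]
    have h1 := indicator_mem_steinberg hf hcl
    have h2 := indicator_mem_steinberg hf hcl.compl
    refine add _ h1 _ h2 (inj _ h1 ((hBi i).mono fun γ hγ => ?_)) (ih h2 fun γ hγ => ?_)
    · exact (Set.indicator_apply_ne_zero.1 hγ).1
    · obtain ⟨k1, k2⟩ := Set.indicator_apply_ne_zero.1 hγ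
      have := ht k2
      rw [Finset.set_biUnion_insert] at this
      exact this.resolve_left k1

/-- A support on which `r` is injective meets each fibre in at most one point, and finiteness passes
to sums. -/
theorem finite_fiber (h : IsAmple 𝒢) {f : 𝒢 → K} (hf : f ∈ steinberg K 𝒢) (u : 𝒢) :
    {α | r α = u ∧ f α ≠ 0}.Finite := by
  revert u
  refine h.steinberg_induction (P := fun f => ∀ u : 𝒢, {α | r α = u ∧ f α ≠ 0}.Finite)
    (fun u => by simp) (fun f _ g _ hf hg u => ?_) (fun f _ hi u => ?_) hf
  · refine ((hf u).union (hg u)).subset ?_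
    rintro α ⟨h1, h2⟩
    by_cases h3 : f α = 0
    · exact Or.inr ⟨h1, fun h4 => h2 (by simp [h3, h4])⟩
    · exact Or.inl ⟨h1, h3⟩
  · exact Set.Subsingleton.finite fun α hα β hβ => hi hα.2 hβ.2 (hα.1.trans hβ.1.symm)

/-- At most one `α` in the support of `f` has the range of `γ`, and then the convolution at `γ` is
`f α * g (α⁻¹γ)`; if there is none, it is zero. Local constancy is checked in these two cases. -/
theorem conv_mem_of_injOn (h : IsAmple 𝒢) {f g : 𝒢 → K} (hf : f ∈ steinberg K 𝒢)
    (hi : Set.InjOn r (Function.support f)) (hg : g ∈ steinberg K 𝒢) :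
    conv f g ∈ steinberg K 𝒢 := by
  have := h.hausdorff
  have key : ∀ α γ, r α = r γ → f α ≠ 0 → conv f g γ = f α * g (mul (inv α) γ) := by
    intro α γ e hα
    refine conv_eq_single (s_eq_r_inv_mul e) (mul_inv_mul e) fun α' β' h' e' hα' _ => ?_
    exact hi hα' hα (by rw [e, ← e', r_mul _ _ h'])
  have hl : IsLocallyConstant (conv f g) := by
    refine (IsLocallyConstant.iff_eventually_eq _).2 fun γ => ?_
    by_cases hγ : ∃ α, r α = r γ ∧ f α ≠ 0
    · obtain ⟨α, e, hα⟩ := hγ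
      obtain ⟨φ, hφ, hr⟩ := h.isLocalHomeomorph_rng α
      have e' : φ α = rng γ := by
        rw [← hr]
        exact Subtype.ext e
      have ht : rng γ ∈ φ.target := e' ▸ φ.map_source hφ
      -- The local inverse of the range map at `α` supplies the left factor for every `δ` near `γ`,
      -- depending continuously on `δ`.
      have hcont : Filter.Tendsto (fun δ => φ.symm (rng δ)) (𝓝 γ) (𝓝 α) := by
        have h1 := φ.symm.continuousAt (x := rng γ) ht
        have h2 := h1.tendsto.comp h.isLocalHomeomorph_rng.continuous.continuousAt.tendsto
        rwa [← e', φ.left_inv hφ] at h2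
      have h3 := hcont.eventually ((IsLocallyConstant.iff_eventually_eq _).1 hf.1 α)
      have h4 := ((h.continuous_inv.continuousAt.tendsto.comp hcont).prodMk_nhds
        Filter.tendsto_id).eventually (h.eventually_mul_mem ((s_inv α).trans e)
          (hg.1.isOpen_fiber (g (mul (inv α) γ))) rfl)
      have h5 := h.isLocalHomeomorph_rng.continuous.continuousAt.preimage_mem_nhds
        (φ.open_target.mem_nhds ht)
      filter_upwards [h3, h4, h5] with δ k3 k4 k5
      have e5 : r (φ.symm (rng δ)) = r δ := by
        have : rng (φ.symm (rng δ)) = rng δ := by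
          rw [hr] at k5 ⊢
          exact φ.right_inv k5
        exact congrArg Subtype.val this
      have k6 : g (mul (inv (φ.symm (rng δ))) δ) = g (mul (inv α) γ) :=
        k4 ((s_inv _).trans e5)
      rw [key α γ e hα, key _ δ e5 (by rwa [k3]), k3, k6]
    · have h0 : ∀ γ, (¬ ∃ α, r α = r γ ∧ f α ≠ 0) → conv f g γ = 0 := by
        intro γ hγ
        by_contra hne
        obtain ⟨α, β, k1, k2, k3, -⟩ := exists_of_conv_ne_zero hne
        exact hγ ⟨α, by rw [← k2, r_mul _ _ k1], k3⟩
      -- The ranges met by the support form a compact, hence closed set, so having no left factor is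
      -- an open condition on `γ`.
      have hcl : IsClosed (r '' Function.support f) := (hf.2.image h.continuous_r).isClosed
      have hm : r ⁻¹' (r '' Function.support f)ᶜ ∈ 𝓝 γ := by
        refine (hcl.isOpen_compl.preimage h.continuous_r).mem_nhds ?_
        rintro ⟨α, k1, k2⟩
        exact hγ ⟨α, k2, k1⟩
      filter_upwards [hm] with δ hδ
      rw [h0 γ hγ, h0 δ fun ⟨α, k1, k2⟩ => hδ ⟨α, k2, k1⟩]
  -- The support of the convolution lies in the product of the two supports, which is the image of a
  -- closed part of a compact set of pairs.
  have hcl : IsClosed {p : 𝒢 × 𝒢 | s p.1 = r p.2} :=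
    isClosed_eq (h.continuous_s.comp continuous_fst) (h.continuous_r.comp continuous_snd)
  have hcomp := (hcl.isClosedEmbedding_subtypeVal.isCompact_preimage (hf.2.prod hg.2)).image
    h.continuous_mul
  refine ⟨hl, hcomp.of_isClosed_subset (hl.isClopen_fiber 0).compl.isClosed fun γ hγ => ?_⟩
  obtain ⟨α, β, k1, k2, k3, k4⟩ := exists_of_conv_ne_zero hγ
  exact ⟨⟨(α, β), k1⟩, ⟨k3, k4⟩, k2⟩

theorem conv_mem_steinberg (h : IsAmple 𝒢) {f g : 𝒢 → K} (hf : f ∈ steinberg K 𝒢)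
    (hg : g ∈ steinberg K 𝒢) : conv f g ∈ steinberg K 𝒢 := by
  refine h.steinberg_induction (P := fun f => conv f g ∈ steinberg K 𝒢) ?_
    (fun f hf f' hf' h1 h2 => ?_) (fun f hf hi => h.conv_mem_of_injOn hf hi hg) hf
  · rw [conv_zero_left]
    exact zero_mem _
  · rw [conv_add_left _ (h.finite_fiber hf) (h.finite_fiber hf')]
    exact add_mem h1 h2

end IsAmple

end ArrowGroupoid

namespace ArrowGroupoid

/-! ### The grading and the classification of graded ideals -/

section GradedIdeals

variable {K : Type*} [Field K] {𝒢 : Type*} [TopologicalSpace 𝒢] [ArrowGroupoid 𝒢]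
  {Γ : Type*} [Group Γ] {c : Cocycle 𝒢 Γ}

theorem homogeneous_le_steinberg (g : Γ) : homogeneous K c g ≤ steinberg K 𝒢 := fun _ hf => hf.1

theorem indicator_mem_homogeneous (hc : IsLocallyConstant c) {f : 𝒢 → K}
    (hf : f ∈ steinberg K 𝒢) (g : Γ) : {γ | c γ = g}.indicator f ∈ homogeneous K c g :=
  ⟨indicator_mem_steinberg hf (hc.isClopen_fiber g), fun _ h => Set.indicator_of_notMem h f⟩

/-- An element of the Steinberg algebra is the sum of its homogeneous components. -/
theorem exists_sum_indicator (hc : IsLocallyConstant c) {f : 𝒢 → K} (hf : f ∈ steinberg K 𝒢) :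
    ∃ F : Finset Γ, f = ∑ g ∈ F, {γ | c γ = g}.indicator f := by
  classical
  have hfin : (c '' Function.support f).Finite := by
    -- For the discrete topology on `Γ` the cocycle is continuous, so it takes only finitely many
    -- values on the compact support.
    let _ : TopologicalSpace Γ := ⊥
    have : DiscreteTopology Γ := ⟨rfl⟩
    exact (hf.2.image hc.continuous).finite_of_discrete
  refine ⟨hfin.toFinset, funext fun γ => ?_⟩
  simp only [Finset.sum_apply, Set.indicator_apply, Set.mem_ofPred_eq, Finset.sum_ite_eq,
    Set.Finite.mem_toFinset]
  split_ifs with h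
  · rfl
  · by_contra h0
    exact h ⟨γ, h0, rfl⟩

theorem isGrading_homogeneous (hA : IsAmple 𝒢) (hc : IsLocallyConstant c) :
    IsGrading K (homogeneous K c) where
  independent := by
    intro g
    rw [Submodule.disjoint_def]
    intro f hf hf'
    -- Sums of elements of degrees other than `g` vanish on the fibre over `g`, and elements of
    -- degree `g` vanish off it.
    have hle : ⨆ h, ⨆ _ : h ≠ g, homogeneous K c h ≤ steinbergOn K 𝒢 {γ | c γ ≠ g} :=
      iSup₂_le fun h hne f hf => ⟨hf.1, fun γ hγ => hf.2 γ fun e => hne <| by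
        rw [← show c γ = h from e]
        exact not_not.1 hγ⟩
    funext γ
    by_cases hγ : c γ = g
    · exact (hle hf').2 γ (not_not.2 hγ)
    · exact hf.2 γ hγ
  iSup_eq := by
    refine le_antisymm (iSup_le homogeneous_le_steinberg) fun f hf => ?_
    obtain ⟨F, hF⟩ := exists_sum_indicator hc hf
    rw [hF]
    exact sum_mem fun g _ => Submodule.mem_iSup_of_mem g (indicator_mem_homogeneous hc hf g)
  conv_mem g h f hf f' hf' := by
    refine ⟨hA.conv_mem_steinberg hf.1 hf'.1, fun γ hγ => ?_⟩
    by_contra hne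
    obtain ⟨α, β, k1, k2, k3, k4⟩ := exists_of_conv_ne_zero hne
    have e1 : c α = g := by_contra fun e => k3 (hf.2 _ e)
    have e2 : c β = h := by_contra fun e => k4 (hf'.2 _ e)
    apply hγ
    rw [Set.mem_ofPred_eq, ← k2, c.map_mul _ _ k1, e1, e2]

/-- If one factor of `γ = αβ` lies over `U`, then invariance puts `γ` over `U` too, since `r γ = r
α` and `s γ = s β`. Homogeneous components are restrictions, so they still vanish off the restricted
groupoid. -/
theorem isGradedIdeal_steinbergOn_restrict (hA : IsAmple 𝒢) (hc : IsLocallyConstant c)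
    (U : Set (units 𝒢)) (hU : IsInvariant U) :
    IsGradedIdeal (homogeneous K c) (steinbergOn K 𝒢 (restrict U hU).carrier) := by
  refine ⟨⟨fun f hf => hf.1, fun f hf g hg => ?_, fun f hf g hg => ?_⟩, ?_⟩
  · refine ⟨hA.conv_mem_steinberg hf hg.1, fun γ hγ => ?_⟩
    by_contra hne
    obtain ⟨α, β, k1, k2, k3, k4⟩ := exists_of_conv_ne_zero hne
    have h1 : rng β ∈ U := by_contra fun h => k4 (hg.2 β h)
    have h2 : src γ = src β := Subtype.ext (k2 ▸ s_mul _ _ k1)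
    exact hγ ((hU γ).2 (h2 ▸ (hU β).1 h1))
  · refine ⟨hA.conv_mem_steinberg hg.1 hf, fun γ hγ => ?_⟩
    by_contra hne
    obtain ⟨α, β, k1, k2, k3, k4⟩ := exists_of_conv_ne_zero hne
    have h1 : rng α ∈ U := by_contra fun h => k3 (hg.2 α h)
    have h2 : rng γ = rng α := Subtype.ext (k2 ▸ r_mul _ _ k1)
    apply hγ
    change rng γ ∈ U
    rwa [h2]
  · refine le_antisymm (fun f hf => ?_) (iSup_le fun g => inf_le_left)
    obtain ⟨F, hF⟩ := exists_sum_indicator hc hf.1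
    rw [hF]
    refine sum_mem fun g _ => Submodule.mem_iSup_of_mem g ?_
    have h := indicator_mem_homogeneous hc hf.1 g
    exact ⟨⟨h.1, fun γ hγ => Set.indicator_apply_eq_zero.2 fun _ => hf.2 γ hγ⟩, h⟩

/-- The homogeneous components of the elements of a graded ideal belong to the ideal. -/
theorem IsGradedIdeal.indicator_mem {J : Submodule K (𝒢 → K)}
    (hJ : IsGradedIdeal (homogeneous K c) J) {f : 𝒢 → K} (hf : f ∈ J) (g : Γ) :
    {γ | c γ = g}.indicator f ∈ J := by
  classical
  rw [hJ.2] at hf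
  induction hf using Submodule.iSup_induction' with
  | mem h f hf =>
    by_cases e : h = g
    · have : {γ | c γ = g}.indicator f = f := by
        refine Set.indicator_eq_self.2 fun γ hγ => ?_
        by_contra hne
        exact hγ (hf.2.2 γ (e ▸ hne))
      rw [this]
      exact hf.1
    · have : {γ | c γ = g}.indicator f = 0 := by
        refine Set.indicator_eq_zero'.2 (Set.disjoint_left.2 fun γ hγ hγ' => hγ ?_)
        exact hf.2.2 γ fun e' => e (e'.symm.trans hγ')
      rw [this]
      exact zero_mem _
  | zero =>
    rw [Set.indicator_zero']
    exact zero_mem _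
  | add x y _ _ hx hy =>
    rw [Set.indicator_add']
    exact add_mem hx hy

/-- The set of the units at which some element of `J` does not vanish. -/
def unitSupport (J : Submodule K (𝒢 → K)) : Set (units 𝒢) := {u | ∃ f ∈ J, f u.1 ≠ 0}

theorem isOpen_unitSupport {J : Submodule K (𝒢 → K)} (hJ : IsIdeal J) :
    IsOpen (unitSupport J) := by
  have : unitSupport J = ⋃ f ∈ J, Subtype.val ⁻¹' (f ⁻¹' {0}ᶜ) := by
    ext u
    simp [unitSupport]
  rw [this]
  exact isOpen_biUnion fun f hf =>
    ((hJ.le hf).1 _).preimage continuous_subtype_val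

/-- Right translation by a bisection: for a compact open `B` around `γ` with `r` injective on `B`,
the convolution of `f` with the characteristic function of `B⁻¹` takes the value `f γ` at `r γ`. -/
theorem rng_mem_unitSupport (hA : IsAmple 𝒢) {J : Submodule K (𝒢 → K)} (hJ : IsIdeal J)
    {f : 𝒢 → K} (hf : f ∈ J) {γ : 𝒢} (hγ : f γ ≠ 0) : rng γ ∈ unitSupport J := by
  have := hA.hausdorff
  obtain ⟨B, hBo, hBc, hB, -, hBi⟩ := hA.exists_section isOpen_univ (Set.mem_univ γ)
  have hinv : (inv : 𝒢 → 𝒢) '' B = inv ⁻¹' B := by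
    ext x
    constructor
    · rintro ⟨y, hy, rfl⟩
      simpa only [Set.mem_preimage, inv_inv] using hy
    · exact fun hx => ⟨inv x, hx, inv_inv x⟩
  have hmem : ((inv : 𝒢 → 𝒢) '' B).indicator (1 : 𝒢 → K) ∈ steinberg K 𝒢 :=
    indicator_one_mem_steinberg (hinv ▸ hBo.preimage hA.continuous_inv)
      (hBc.image hA.continuous_inv)
  refine ⟨_, hJ.conv_mem_right _ hmem f hf, ?_⟩
  have e : conv f (((inv : 𝒢 → 𝒢) '' B).indicator (1 : 𝒢 → K)) (r γ) = f γ := by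
    rw [conv_eq_single (r_inv γ).symm (mul_inv γ)]
    · rw [Set.indicator_of_mem (Set.mem_image_of_mem _ hB), Pi.one_apply, mul_one]
    -- A factorisation of the unit `r γ` has `β = α⁻¹`, so `α` lies in `B` with the range of `γ` and
    -- must be `γ`.
    · intro α β h e _ hβ
      have h1 := (Set.indicator_apply_ne_zero.1 hβ).1
      have h2 : r α = r γ := by rw [← r_mul _ _ h, e, r_r]
      have h3 : β = inv α := by
        rw [eq_inv_mul h e, ← h2, ← s_inv α, mul_s_self]
      rw [hinv, h3, Set.mem_preimage, inv_inv] at h1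
      exact hBi h1 hB h2
  exact e ▸ hγ

/-- Left translation by a bisection around `γ` moves the value of `f` at `s γ` to `γ`, and
`rng_mem_unitSupport` then reaches the range. The other direction is the same argument for `inv γ`.
-/
theorem isInvariant_unitSupport (hA : IsAmple 𝒢) {J : Submodule K (𝒢 → K)} (hJ : IsIdeal J) :
    IsInvariant (unitSupport J) := by
  have := hA.hausdorff
  have key : ∀ γ : 𝒢, src γ ∈ unitSupport J → rng γ ∈ unitSupport J := by
    rintro γ ⟨f, hf, hne⟩
    obtain ⟨B, hBo, hBc, hB, -, hBi⟩ := hA.exists_section isOpen_univ (Set.mem_univ γ)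
    refine rng_mem_unitSupport hA hJ
      (hJ.conv_mem_left _ (indicator_one_mem_steinberg hBo hBc) f hf) ?_
    rw [conv_eq_single (r_s γ).symm (mul_s_self γ), Set.indicator_of_mem hB, Pi.one_apply, one_mul]
    · exact hne
    · intro α β h e hα _
      exact hBi (Set.indicator_apply_ne_zero.1 hα).1 hB (by rw [← e, r_mul _ _ h])
  refine fun γ => ⟨fun h => ?_, key γ⟩
  have h1 : src (inv γ) = rng γ := Subtype.ext (s_inv γ)
  have h2 : rng (inv γ) = src γ := Subtype.ext (r_inv γ)
  exact h2 ▸ key (inv γ) (h1 ▸ h)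

/-- If the kernel of the cocycle is principal, then the graded ideal `J` contains the
characteristic functions of small neighbourhoods of the units in `unitSupport J`. -/
theorem exists_indicator_one_mem (hA : IsAmple 𝒢) (hp : IsPrincipal c.ker.carrier)
    {J : Submodule K (𝒢 → K)} (hJ : IsGradedIdeal (homogeneous K c) J) {u : units 𝒢}
    (hu : u ∈ unitSupport J) :
    ∃ W : Set 𝒢, W ⊆ units 𝒢 ∧ IsOpen W ∧ IsCompact W ∧ u.1 ∈ W ∧
      W.indicator (1 : 𝒢 → K) ∈ J := by
  have := hA.hausdorff
  obtain ⟨f₀, hf₀, hne₀⟩ := hu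
  -- Pass to the component of degree `1`: it stays in `J` because `J` is graded, and it keeps its
  -- value at `u` because units have degree `1`.
  set f := {γ | c γ = 1}.indicator f₀ with hf_def
  have hf : f ∈ J := hJ.indicator_mem hf₀ 1
  have hu1 : r u.1 = u.1 := u.2
  have hne : f u.1 ≠ 0 := by
    have hcu : c u.1 = 1 := hu1 ▸ c.map_r u.1
    rwa [hf_def, Set.indicator_of_mem (show u.1 ∈ {γ | c γ = 1} from hcu)]
  have hfs := hJ.1.le hf
  have hker : ∀ γ, f γ ≠ 0 → r γ = s γ → γ ∈ units 𝒢 := by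
    intro γ hγ e
    have hcγ : c γ = 1 := (Set.indicator_apply_ne_zero.1 hγ).1
    have h1 : (⟨γ, hcγ⟩ : c.ker.carrier) ∈ isotropy c.ker.carrier := Subtype.ext e
    rw [hp] at h1
    exact congrArg Subtype.val h1
  -- By principality the map `(r, s)` sends no point of this compact set to `(u, u)`, so its closed
  -- image misses a neighbourhood `O × O'` of `(u, u)`.
  have hC : IsCompact (Function.support f \ units 𝒢) := hfs.2.diff hA.isOpen_units
  have hD := (hC.image (hA.continuous_r.prodMk hA.continuous_s)).isClosed.isOpen_compl
  have hmem : (u.1, u.1) ∈ ((fun γ => (r γ, s γ)) '' (Function.support f \ units 𝒢))ᶜ := by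
    rintro ⟨γ, ⟨h1, h2⟩, h3⟩
    exact h2 (hker γ h1 ((congrArg Prod.fst h3).trans (congrArg Prod.snd h3).symm))
  obtain ⟨O, O', hO, hO', huO, huO', hsub⟩ := isOpen_prod_iff.1 hD _ _ hmem
  obtain ⟨W, hWo, hWc, huW, hW, -⟩ := hA.exists_section
    (((hO.inter hO').inter (hfs.1.isOpen_fiber (f u.1))).inter hA.isOpen_units)
    ⟨⟨⟨huO, huO'⟩, rfl⟩, u.2⟩
  have hWu : W ⊆ units 𝒢 := hW.trans Set.inter_subset_right
  refine ⟨W, hWu, hWo, hWc, huW, ?_⟩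
  have h1 := indicator_one_mem_steinberg (K := K) hWo hWc
  have h2 := hJ.1.conv_mem_left _ h1 _ (hJ.1.conv_mem_right _ h1 f hf)
  -- On `W` the function `f` is constant. A non-unit in the support of the compressed function would
  -- have range and source in `W`, contradicting the choice of `O × O'`.
  have e : W.indicator (1 : 𝒢 → K) =
      (f u.1)⁻¹ • conv (W.indicator 1) (conv f (W.indicator 1)) := by
    funext γ
    rw [Pi.smul_apply, conv_of_units_left (indicator_one_apply_units hWu),
      conv_of_units_right (indicator_one_apply_units hWu), smul_eq_mul]
    by_cases hγu : γ ∈ units 𝒢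
    · rw [s_of_mem_units hγu, show r γ = γ from hγu]
      by_cases hγ : γ ∈ W
      · have hfγ : f γ = f u.1 := (hW hγ).1.2
        rw [Set.indicator_of_mem hγ, hfγ, Pi.one_apply, one_mul, mul_one, inv_mul_cancel₀ hne]
      · rw [Set.indicator_of_notMem hγ, zero_mul, mul_zero]
    · rw [indicator_one_apply_units hWu γ hγu, eq_comm]
      by_contra h0
      have h0' := right_ne_zero_of_mul h0
      have k1 := (Set.indicator_apply_ne_zero.1 (left_ne_zero_of_mul h0')).1
      have k2 := left_ne_zero_of_mul (right_ne_zero_of_mul h0')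
      have k3 := (Set.indicator_apply_ne_zero.1
        (right_ne_zero_of_mul (right_ne_zero_of_mul h0'))).1
      exact hsub (Set.mk_mem_prod (hW k1).1.1.1 (hW k3).1.1.2) ⟨γ, ⟨k2, hγu⟩, rfl⟩
  rw [e]
  exact J.smul_mem _ h2

/-- A graded ideal is determined by the units at which it does not vanish. -/
theorem IsGradedIdeal.eq_steinbergOn (hA : IsAmple 𝒢) (hp : IsPrincipal c.ker.carrier)
    {J : Submodule K (𝒢 → K)} (hJ : IsGradedIdeal (homogeneous K c) J) :
    J = steinbergOn K 𝒢
      (restrict (unitSupport J) (isInvariant_unitSupport hA hJ.1)).carrier := by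
  classical
  have := hA.hausdorff
  refine le_antisymm (fun f hf => ?_) fun f hf => ?_
  · refine ⟨hJ.1.le hf, fun γ hγ => ?_⟩
    by_contra hne
    exact hγ (rng_mem_unitSupport hA hJ.1 hf hne)
  · choose W hWu hWo hWc hW hWJ using
      fun u : unitSupport J => exists_indicator_one_mem hA hp hJ u.2
    -- The ranges of the support of `f` form a compact subset of `unitSupport J`, so finitely many
    -- `W i` cover it.
    obtain ⟨t, ht⟩ := (hf.1.2.image hA.continuous_r).elim_finite_subcover W hWo (by
      rintro _ ⟨γ, hγ, rfl⟩
      have hU : rng γ ∈ unitSupport J := by_contra fun h => hγ (hf.2 γ h)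
      exact Set.mem_iUnion.2 ⟨⟨rng γ, hU⟩, hW ⟨rng γ, hU⟩⟩)
    have key : ∀ t : Finset (unitSupport J),
        (⋃ i ∈ t, W i).indicator (1 : 𝒢 → K) ∈ J := by
      intro t
      induction t using Finset.induction_on with
      | empty =>
        have : (⋃ i ∈ (∅ : Finset (unitSupport J)), W i).indicator (1 : 𝒢 → K) = 0 := by
          simp only [Finset.notMem_empty, Set.iUnion_of_empty, Set.iUnion_empty,
            Set.indicator_empty']
        rw [this]
        exact zero_mem _
      | insert i t _ ih =>
        rw [Finset.set_biUnion_insert]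
        set Z := ⋃ i ∈ t, W i
        have hZu : Z ⊆ units 𝒢 := Set.iUnion₂_subset fun i _ => hWu i
        -- On units convolution is pointwise multiplication, so inclusion–exclusion keeps the
        -- characteristic function of the union in `J`.
        have hprod : (W i ∩ Z).indicator (1 : 𝒢 → K) =
            conv ((W i).indicator 1) (Z.indicator 1) := by
          funext γ
          rw [conv_of_units_left (indicator_one_apply_units (hWu i))]
          by_cases hγ : γ ∈ Z
          · rw [show r γ = γ from hZu hγ]
            by_cases hγ' : γ ∈ W i <;> simp [hγ, hγ']
          · simp [hγ]
        have e := Set.indicator_union_add_inter (1 : 𝒢 → K) (W i) Z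
        rw [← eq_sub_iff_add_eq] at e
        rw [e, hprod]
        exact sub_mem (add_mem (hWJ i) ih)
          (hJ.1.conv_mem_left _ (hJ.1.le (hWJ i)) _ ih)
    have hZu : (⋃ i ∈ t, W i) ⊆ units 𝒢 := Set.iUnion₂_subset fun i _ => hWu i
    -- The characteristic function of the cover is a left unit for `f`, so `f` is a product with an
    -- element of `J` as a factor.
    have e : f = conv ((⋃ i ∈ t, W i).indicator 1) f := by
      funext γ
      rw [conv_of_units_left (indicator_one_apply_units hZu)]
      by_cases hγ : f γ = 0
      · rw [hγ, mul_zero]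
      · rw [Set.indicator_of_mem (ht ⟨γ, hγ, rfl⟩), Pi.one_apply, one_mul]
    rw [e]
    exact hJ.1.conv_mem_right f hf.1 _ (key t)

/-- The characteristic function of a small compact open set around `u`, contained in the arrows over
`U`, detects whether `u` belongs to `U'`. -/
theorem subset_of_steinbergOn_le (hA : IsAmple 𝒢) {U U' : Set (units 𝒢)} (hUo : IsOpen U)
    (hU : IsInvariant U) (hU' : IsInvariant U')
    (hle : steinbergOn K 𝒢 (restrict U hU).carrier ≤ steinbergOn K 𝒢 (restrict U' hU').carrier) :
    U ⊆ U' := by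
  intro u hu
  have := hA.hausdorff
  have hru : rng u.1 = u := Subtype.ext u.2
  obtain ⟨W, hWo, hWc, huW, hW, -⟩ := hA.exists_section
    (hUo.preimage hA.isLocalHomeomorph_rng.continuous) (show u.1 ∈ rng ⁻¹' U by
      rwa [Set.mem_preimage, hru])
  have h := hle (x := W.indicator (1 : 𝒢 → K))
    ⟨indicator_one_mem_steinberg hWo hWc, fun γ hγ =>
      Set.indicator_of_notMem (fun h => hγ (hW h)) _⟩
  by_contra hu'
  have := h.2 u.1 (fun h => hu' (hru ▸ h))
  rw [Set.indicator_of_mem huW] at this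
  exact one_ne_zero this

/-- If `c` is a locally constant cocycle on an ample groupoid with principal kernel, then
`U ↦ A_K(𝒢|_U)` is an isomorphism from the lattice of open invariant sets of units onto the
lattice of graded ideals. -/
theorem exists_orderIso_gradedIdeals (hA : IsAmple 𝒢) (hc : IsLocallyConstant c)
    (hp : IsPrincipal c.ker.carrier) :
    ∃ Ψ : {U : Set (units 𝒢) // IsOpen U ∧ IsInvariant U} ≃o
        {J : Submodule K (𝒢 → K) // IsGradedIdeal (homogeneous K c) J},
      ∀ U, (Ψ U : Submodule K (𝒢 → K)) = steinbergOn K 𝒢 (restrict U.1 U.2.2).carrier := by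
  let F : {U : Set (units 𝒢) // IsOpen U ∧ IsInvariant U} ↪o
      {J : Submodule K (𝒢 → K) // IsGradedIdeal (homogeneous K c) J} :=
    OrderEmbedding.ofMapLEIff
      (fun U => ⟨_, isGradedIdeal_steinbergOn_restrict hA hc U.1 U.2.2⟩)
      fun U U' => ⟨fun h => subset_of_steinbergOn_le hA U.2.1 U.2.2 U'.2.2 h,
        fun h => steinbergOn_mono fun _ hγ => h hγ⟩
  refine ⟨RelIso.ofSurjective F fun J => ?_, fun U => rfl⟩
  exact ⟨⟨unitSupport J.1, isOpen_unitSupport J.2.1, isInvariant_unitSupport hA J.2.1⟩,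
    Subtype.ext (J.2.eq_steinbergOn hA hp).symm⟩

end GradedIdeals

/-! ### Principal groupoids with open unit space -/

section Principal

variable {𝒢 : Type*} [TopologicalSpace 𝒢] [ArrowGroupoid 𝒢]

/-- In every restriction the isotropy is again the unit space, which is open and therefore its own
interior. -/
theorem isStronglyEffective_of_isPrincipal (hp : IsPrincipal 𝒢) (ho : IsOpen (units 𝒢)) :
    IsStronglyEffective 𝒢 := by
  intro C hC _
  have h : isotropy (restrict C hC).carrier = units (restrict C hC).carrier := by
    rw [units_sub, ← hp]
    ext γ
    exact Subtype.ext_iff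
  rw [IsEffective, h, units_sub]
  exact (ho.preimage continuous_subtype_val).interior_eq

end Principal

end ArrowGroupoid

namespace GraphTriple

section

variable {G V E : Type*} [Group G] [MulAction G V] [MulAction G E] {T : GraphTriple G V E}

/-! ### Extending and composing triples -/

namespace InfPath

theorem act_initial (g : G) (ξ : T.InfPath) (n : ℕ) :
    (ξ.initial n).act g = (ξ.act g).initial n :=
  FinPath.ext (ξ.rng_act g).symm (ξ.take_act g n).symm

theorem act_inv_act (g : G) (ξ : T.InfPath) : (ξ.act g).act g⁻¹ = ξ := by
  rw [← act_mul, inv_mul_cancel, act_one]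

theorem act_act_inv (g : G) (ξ : T.InfPath) : (ξ.act g⁻¹).act g = ξ := by
  rw [← act_mul, mul_inv_cancel, act_one]

end InfPath

theorem FinPath.append_initial (α : T.FinPath) (ξ : T.InfPath) (h : α.src = ξ.rng) (n : ℕ) :
    α.append (ξ.initial n) h = (α.prepend ξ h).initial (α.length + n) :=
  FinPath.ext (α.rng_prepend ξ h).symm (α.take_prepend ξ h n).symm

namespace Triple

/-- The triple `(α (gε), φ(g, ε), βε)`, that is, the product of `(α, g, β)` and the idempotent
of `βε`. -/
def extend (x : T.Triple) (ε : T.FinPath) (h : x.β.src = ε.rng) : T.Triple where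
  α := x.α.append (ε.act x.g) (mul_aux₃ x ε h)
  g := ε.coc x.g
  β := x.β.append ε h
  src_eq := by rw [FinPath.src_append, FinPath.src_append, FinPath.src_act, FinPath.coc_smul]

theorem src_extend (x : T.Triple) (ε : T.FinPath) (h : x.β.src = ε.rng) :
    (x.extend ε h).β.src = ε.src := FinPath.src_append _ _ h

/-- The product `(α, gh, γ)` of `(α, g, β)` and `(β, h, γ)`. -/
def comp (x y : T.Triple) (h : x.β = y.α) : T.Triple :=
  ⟨x.α, x.g * y.g, y.β, by rw [x.src_eq, h, y.src_eq, mul_smul]⟩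

/-- The cocycle identity for finite paths. It lets the extension wanted for a product be distributed
over the factors, which is what continuity of multiplication needs. -/
theorem extend_comp_extend (x y : T.Triple) (h : x.β = y.α) (ε : T.FinPath)
    (k : y.β.src = ε.rng) (l : x.β.src = (ε.act y.g).rng)
    (m : (x.extend (ε.act y.g) l).β = (y.extend ε k).α) :
    (x.extend (ε.act y.g) l).comp (y.extend ε k) m = (x.comp y h).extend ε k := by
  refine Triple.ext (FinPath.ext rfl ?_) (T.cocList_mul _ _ _).symm rfl
  change x.α.edges ++ T.actList x.g (T.actList y.g ε.edges) =
    x.α.edges ++ T.actList (x.g * y.g) ε.edges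
  rw [actList_mul]

theorem mul_of_eq (x y : T.Triple) (h : x.β = y.α) : x.mul y = some (x.comp y h) := by
  -- Equal inner paths are the case of the product rule in which `ε` is a vertex.
  have k : y.α.src = (FinPath.ofVertex (T := T) y.α.src).rng := rfl
  rw [mul_of_left x y (FinPath.ofVertex y.α.src) k
    (h.trans (FinPath.ext rfl (List.append_nil _).symm))]
  congr 1
  refine Triple.ext rfl ?_ (FinPath.ext rfl (List.append_nil _))
  simp [comp, FinPath.coc, FinPath.ofVertex, cocList]

end Triple

/-! ### Bisections of triples as a basis of the topology -/

namespace Germ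

open ArrowGroupoid

/-- Moving an initial segment of the tail into the triple preserves the germ, since source and range
are unchanged and the cocycle sequence is only shifted, by the amount that `|α|` grows. -/
theorem mk_extend (x : T.Triple) (ε : T.FinPath) (h : x.β.src = ε.rng) (ξ : T.InfPath)
    (k : ε.src = ξ.rng) :
    mk ⟨x.extend ε h, ξ, (x.src_extend ε h).trans k⟩ =
      mk ⟨x, ε.prepend ξ k, h.trans (ε.rng_prepend ξ k).symm⟩ := by
  refine mk_eq_mk.2 ((PreGerm.rel_iff _ _).2 ⟨?_, ?_, ?_⟩)
  · exact FinPath.prepend_append x.β ε ξ h ((x.src_extend ε h).trans k)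
  · refine (FinPath.prepend_append x.α (ε.act x.g) (ξ.act (ε.coc x.g)) (x.mul_aux₃ ε h)
      (PreGerm.act_eq ⟨x.extend ε h, ξ, (x.src_extend ε h).trans k⟩)).trans ?_
    simp only [PreGerm.target, FinPath.act_prepend]
  · refine (PreGerm.lag_eq_iff _ _).2 ⟨?_, 0, fun n _ => ?_⟩
    · simp only [Triple.extend, FinPath.length_append, FinPath.length_act]
      omega
    · simp only [Triple.extend, FinPath.length_append, FinPath.length_act]
      rw [add_comm x.α.length ε.length, add_assoc, FinPath.Phi_prepend]

/-- The set of all germs `[α, g, β; βξ]` of the triple `(α, g, β)`. -/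
def bisection (x : T.Triple) : Set T.Germ := {γ | ∃ ξ h, γ = mk ⟨x, ξ, h⟩}

theorem bisection_extend_subset (x : T.Triple) (ε : T.FinPath) (h : x.β.src = ε.rng) :
    bisection (x.extend ε h) ⊆ bisection x := by
  rintro _ ⟨ξ, k, rfl⟩
  have k' : ε.src = ξ.rng := (x.src_extend ε h).symm.trans k
  exact ⟨_, _, mk_extend x ε h ξ k'⟩

theorem mk_extend_initial (p : T.PreGerm) (n : ℕ) :
    mk ⟨p.x.extend (p.ξ.initial n) p.src_eq, p.ξ.drop n,
      (p.x.src_extend _ p.src_eq).trans (p.ξ.src_initial n)⟩ = mk p := by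
  refine (mk_extend p.x (p.ξ.initial n) p.src_eq _ (p.ξ.src_initial n)).trans ?_
  congr 1
  exact PreGerm.ext rfl (p.ξ.initial_prepend_drop n)

theorem mem_bisection_extend (p : T.PreGerm) (n : ℕ) :
    mk p ∈ bisection (p.x.extend (p.ξ.initial n) p.src_eq) :=
  ⟨_, _, (mk_extend_initial p n).symm⟩

theorem extend_initial_α (p : T.PreGerm) (n : ℕ) :
    (p.x.extend (p.ξ.initial n) p.src_eq).α = p.target.initial (p.x.α.length + n) := by
  rw [PreGerm.target, ← FinPath.append_initial]
  simp only [Triple.extend, InfPath.act_initial]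

theorem extend_initial_β (p : T.PreGerm) (n : ℕ) :
    (p.x.extend (p.ξ.initial n) p.src_eq).β = p.base.initial (p.x.β.length + n) :=
  FinPath.append_initial _ _ _ _

/-- Two triples with a common germ have a common extension. -/
theorem exists_extend_eq {p q : T.PreGerm} (h : mk p = mk q) :
    ∃ m n, p.x.extend (p.ξ.initial m) p.src_eq = q.x.extend (q.ξ.initial n) q.src_eq := by
  obtain ⟨h1, h2, h3⟩ := (PreGerm.rel_iff p q).1 (mk_eq_mk.1 h)
  obtain ⟨hl, N, hN⟩ := (PreGerm.lag_eq_iff p q).1 h3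
  -- The lengths are chosen crosswise, so that both extended range paths have length `|α| + |α'| +
  -- N`. Equality of the degrees matches the source paths, and `N` is large enough for the group
  -- elements to agree.
  refine ⟨q.x.α.length + N, p.x.α.length + N, Triple.ext ?_ (hN N le_rfl) ?_⟩
  · rw [extend_initial_α, extend_initial_α, h2]
    congr 1
    omega
  · rw [extend_initial_β, extend_initial_β, h1]
    congr 1
    omega

theorem Theta_self (x : T.Triple) : Theta x x.β = bisection x := by
  ext γ
  constructor
  · rintro ⟨ξ, h, -, e⟩
    exact ⟨ξ, h, e⟩
  · rintro ⟨ξ, h, e⟩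
    exact ⟨ξ, h, ⟨ξ, h, rfl⟩, e⟩

/-- `δ` and `x.β` are initial segments of one infinite path. If `δ` is the shorter, the cylinder
condition is automatic on `bisection x`; otherwise extend `x` until its source path is `δ`. -/
theorem exists_bisection_subset_Theta {x : T.Triple} {δ : T.FinPath} {γ : T.Germ}
    (hγ : γ ∈ Theta x δ) : ∃ y, γ ∈ bisection y ∧ bisection y ⊆ Theta x δ := by
  obtain ⟨ξ, h, ⟨η, k, e⟩, rfl⟩ := hγ
  rcases le_total δ.length x.β.length with hl | hl
  · obtain ⟨ε, k1, k2, e1, e2⟩ := FinPath.exists_append e hl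
    refine ⟨x, ⟨ξ, h, rfl⟩, ?_⟩
    rintro _ ⟨ξ', h', rfl⟩
    refine ⟨ξ', h', ?_, rfl⟩
    have h2 : (δ.append ε k1).src = ξ'.rng := e1 ▸ h'
    refine ⟨ε.prepend ξ' ((FinPath.src_append _ _ _).symm.trans h2),
      k1.trans (FinPath.rng_prepend _ _ _).symm, ?_⟩
    rw [← FinPath.prepend_append δ ε ξ' k1 h2]
    congr 1
  · obtain ⟨ε, k1, k2, e1, e2⟩ := FinPath.exists_append e.symm hl
    refine ⟨x.extend ε k1, ⟨η, (x.src_extend ε k1).trans k2, ?_⟩, ?_⟩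
    · rw [mk_extend x ε k1 η k2]
      congr 1
      exact PreGerm.ext rfl e2
    · rintro _ ⟨ξ', h', rfl⟩
      have k' : ε.src = ξ'.rng := (x.src_extend ε k1).symm.trans h'
      refine ⟨_, k1.trans (FinPath.rng_prepend _ _ k').symm, ?_, mk_extend x ε k1 ξ' k'⟩
      have h2 : (x.β.append ε k1).src = ξ'.rng := h'
      refine ⟨ξ', e1 ▸ h2, ?_⟩
      rw [← FinPath.prepend_append x.β ε ξ' k1 h2]
      congr 1
      exact e1.symm

/-- Intersections are handled by `exists_extend_eq`: a common extension of two triples gives a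
bisection inside both. The generating sets `Theta x δ` are unions of bisections, and each bisection
is one of them. -/
theorem isTopologicalBasis_bisection :
    TopologicalSpace.IsTopologicalBasis (Set.range (bisection : T.Triple → Set T.Germ)) where
  exists_subset_inter := by
    rintro _ ⟨x, rfl⟩ _ ⟨y, rfl⟩ _ ⟨⟨ξ, h, rfl⟩, ⟨η, k, e⟩⟩
    obtain ⟨m, n, e'⟩ := exists_extend_eq e
    refine ⟨_, ⟨_, rfl⟩, mem_bisection_extend ⟨x, ξ, h⟩ m,
      Set.subset_inter (bisection_extend_subset _ _ _) ?_⟩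
    rw [e']
    exact bisection_extend_subset _ _ _
  sUnion_eq := by
    refine Set.eq_univ_of_forall fun γ => ?_
    induction γ using Quotient.ind with
    | _ p => exact ⟨_, ⟨p.x, rfl⟩, p.ξ, p.src_eq, rfl⟩
  eq_generateFrom := by
    refine le_antisymm (le_generateFrom ?_) (le_generateFrom ?_)
    · rintro _ ⟨x, rfl⟩
      exact TopologicalSpace.isOpen_generateFrom_of_mem ⟨x, x.β, (Theta_self x).symm⟩
    · rintro _ ⟨x, δ, rfl⟩
      have e : Theta x δ = ⋃₀ {W ∈ Set.range bisection | W ⊆ Theta x δ} := by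
        refine Set.Subset.antisymm (fun γ hγ => ?_) (Set.sUnion_subset fun W hW => hW.2)
        obtain ⟨y, h1, h2⟩ := exists_bisection_subset_Theta hγ
        exact ⟨_, ⟨⟨y, rfl⟩, h2⟩, h1⟩
      rw [e]
      exact .sUnion _ fun W hW => .basic W hW.1

theorem isOpen_bisection (x : T.Triple) : IsOpen (bisection x) :=
  isTopologicalBasis_bisection.isOpen ⟨x, rfl⟩

/-- The extensions of any single representative already give a neighbourhood base of its germ. -/
theorem exists_extend_subset (p : T.PreGerm) {O : Set T.Germ} (hO : IsOpen O) (hp : mk p ∈ O) :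
    ∃ n, bisection (p.x.extend (p.ξ.initial n) p.src_eq) ⊆ O := by
  obtain ⟨_, ⟨y, rfl⟩, ⟨ξ, h, e⟩, hy⟩ :=
    isTopologicalBasis_bisection.exists_subset_of_mem_open hp hO
  obtain ⟨m, n, e'⟩ := exists_extend_eq e
  refine ⟨m, ?_⟩
  rw [e']
  exact (bisection_extend_subset _ _ _).trans hy

theorem isLocallyConstant_srcPath_edge (i : ℕ) :
    IsLocallyConstant fun γ : T.Germ => γ.srcPath.edge i := by
  refine (IsLocallyConstant.iff_eventually_eq _).2 fun γ => ?_
  induction γ using Quotient.ind with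
  | _ p =>
    -- After an extension by `i + 1` edges the source path is long enough for its edge number `i` to
    -- be read off from the triple alone.
    have hi : i < (p.x.extend (p.ξ.initial (i + 1)) p.src_eq).β.edges.length := by
      change _ < FinPath.length _
      rw [extend_initial_β, InfPath.length_initial]
      omega
    have key : ∀ γ ∈ bisection (p.x.extend (p.ξ.initial (i + 1)) p.src_eq),
        γ.srcPath.edge i = (p.x.extend (p.ξ.initial (i + 1)) p.src_eq).β.edges[i] := by
      rintro _ ⟨ξ, h, rfl⟩
      exact FinPath.prepend_edge_lt _ _ h _ hi
    filter_upwards [(isOpen_bisection _).mem_nhds (mem_bisection_extend p (i + 1))] with δ hδ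
    exact (key δ hδ).trans (key _ (mem_bisection_extend p (i + 1))).symm

theorem isLocallyConstant_rngPath_edge (i : ℕ) :
    IsLocallyConstant fun γ : T.Germ => γ.rngPath.edge i := by
  refine (IsLocallyConstant.iff_eventually_eq _).2 fun γ => ?_
  induction γ using Quotient.ind with
  | _ p =>
    have hi : i < (p.x.extend (p.ξ.initial (i + 1)) p.src_eq).α.edges.length := by
      change _ < FinPath.length _
      rw [extend_initial_α, InfPath.length_initial]
      omega
    have key : ∀ γ ∈ bisection (p.x.extend (p.ξ.initial (i + 1)) p.src_eq),
        γ.rngPath.edge i = (p.x.extend (p.ξ.initial (i + 1)) p.src_eq).α.edges[i] := by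
      rintro _ ⟨ξ, h, rfl⟩
      exact FinPath.prepend_edge_lt _ _ (PreGerm.act_eq ⟨_, ξ, h⟩) _ hi
    filter_upwards [(isOpen_bisection _).mem_nhds (mem_bisection_extend p (i + 1))] with δ hδ
    exact (key δ hδ).trans (key _ (mem_bisection_extend p (i + 1))).symm

/-! ### The unit space as a space of infinite paths -/

theorem unit_srcPath_of_mem_units {u : T.Germ} (h : u ∈ units T.Germ) : unit u.srcPath = u :=
  s_of_mem_units h

theorem exists_unit_mem_of_isOpen {η : T.InfPath} {O : Set T.Germ} (hO : IsOpen O)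
    (h : unit η ∈ O) :
    ∃ n, ∀ η' : T.InfPath, (∀ i < n, η'.edge i = η.edge i) → unit η' ∈ O := by
  obtain ⟨n, hn⟩ := exists_extend_subset (PreGerm.unit η) hO h
  -- One edge more than the extension requires: even for `n = 0` the first edge is needed to fix the
  -- range vertex.
  refine ⟨n + 1, fun η' h' => hn ?_⟩
  have hr : η'.rng = η.rng := congrArg T.r (h' 0 n.succ_pos)
  have ht : η'.take n = η.take n :=
    List.map_congr_left fun i hi => h' i (Nat.lt_succ_of_lt (List.mem_range.1 hi))
  have e : (PreGerm.unit η').x.extend ((PreGerm.unit η').ξ.initial n) (PreGerm.unit η').src_eq =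
      (PreGerm.unit η).x.extend ((PreGerm.unit η).ξ.initial n) (PreGerm.unit η).src_eq :=
    Triple.ext (FinPath.ext hr (congrArg (T.actList 1) ht)) (congrArg (T.cocList 1) ht)
      (FinPath.ext hr ht)
  exact e ▸ mem_bisection_extend (PreGerm.unit η') n

/-- The unit space is a closed subspace of the space of all sequences of edges. -/
theorem isClosedEmbedding_units [TopologicalSpace E] [DiscreteTopology E] :
    IsClosedEmbedding fun u : units T.Germ => u.1.srcPath.edge := by
  have hcont : Continuous fun u : units T.Germ => u.1.srcPath.edge :=
    continuous_pi fun i =>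
      (isLocallyConstant_srcPath_edge i).continuous.comp continuous_subtype_val
  refine ⟨⟨isInducing_iff_nhds.2 fun u => le_antisymm hcont.continuousAt.tendsto.le_comap ?_,
    fun u v h => ?_⟩, ?_⟩
  · intro O hO
    obtain ⟨O', hO', hO'o, hu⟩ := mem_nhds_iff.1 hO
    obtain ⟨W, hW, rfl⟩ := isOpen_induced_iff.1 hO'o
    rw [Set.mem_preimage, ← unit_srcPath_of_mem_units u.2] at hu
    obtain ⟨n, hn⟩ := exists_unit_mem_of_isOpen hW hu
    have hfin : {f : ℕ → E | ∀ i < n, f i = u.1.srcPath.edge i} ∈ 𝓝 u.1.srcPath.edge := by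
      refine (Set.finite_lt_nat n).eventually_all.2 fun i _ => ?_
      exact IsOpen.mem_nhds ((isOpen_discrete {u.1.srcPath.edge i}).preimage
        (continuous_apply (A := fun _ : ℕ => E) i)) rfl
    refine ⟨_, hfin, fun v hv => hO' ?_⟩
    rw [Set.mem_preimage, ← unit_srcPath_of_mem_units v.2]
    exact hn _ hv
  · apply Subtype.ext
    rw [← unit_srcPath_of_mem_units u.2, ← unit_srcPath_of_mem_units v.2]
    exact congrArg unit (InfPath.ext h)
  -- The image is cut out by the path condition on consecutive edges, each instance of which
  -- involves two coordinates and is clopen.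
  · have : (Set.range fun u : units T.Germ => u.1.srcPath.edge) =
        ⋂ n, (fun f : ℕ → E => (f n, f (n + 1))) ⁻¹' {p | T.s p.1 = T.r p.2} := by
      ext f
      simp only [Set.mem_range, Set.mem_iInter, Set.mem_preimage, Set.mem_ofPred_eq]
      constructor
      · rintro ⟨u, rfl⟩ n
        exact u.1.srcPath.valid n
      · intro hf
        exact ⟨⟨unit ⟨f, hf⟩, congrArg unit (rngPath_unit _)⟩,
          congrArg InfPath.edge (srcPath_unit _)⟩
    rw [this]
    exact isClosed_iInter fun n => (isClosed_discrete _).preimage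
      ((continuous_apply n).prodMk (continuous_apply (n + 1)))

/-! ### The range map is a local homeomorphism -/

theorem continuous_rng : Continuous (rng : T.Germ → units T.Germ) := by
  let _ : TopologicalSpace E := ⊥
  have : DiscreteTopology E := ⟨rfl⟩
  refine isClosedEmbedding_units.isInducing.continuous_iff.2 (continuous_pi fun i => ?_)
  have h : (fun γ : T.Germ => (rng γ).1.srcPath.edge i) = fun γ => γ.rngPath.edge i := by
    funext γ
    exact congrArg (fun η : T.InfPath => η.edge i) (srcPath_unit _)
  exact h ▸ (isLocallyConstant_rngPath_edge i).continuous

theorem unit_prepend (α : T.FinPath) (ξ : T.InfPath) (h : α.src = ξ.rng) :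
    unit (α.prepend ξ h) = mk ⟨Triple.ofPair α α rfl, ξ, h⟩ := by
  refine ext' (srcPath_unit _) ((rngPath_unit _).trans ?_) ((lagFun_unit _).trans ?_)
  · change _ = α.prepend (ξ.act 1) (by rw [ξ.act_one, h])
    congr 1
    exact ξ.act_one.symm
  · refine SemidirectProduct.ext ?_ ?_
    · change 1 = coronaAction G _ (QuotientGroup.mk (ξ.Phi 1))
      rw [InfPath.Phi_one, QuotientGroup.mk_one, map_one]
    · exact (congrArg Multiplicative.ofAdd (sub_self _)).symm

/-- Since `g` acts bijectively on infinite paths, the ranges of the germs of `(α, g, β)` are all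
paths that begin with `α`. Openness of the range map follows. -/
theorem image_rng_bisection (x : T.Triple) :
    rng '' bisection x = Subtype.val ⁻¹' bisection (Triple.ofPair x.α x.α rfl) := by
  ext u
  constructor
  · rintro ⟨_, ⟨ξ, h, rfl⟩, rfl⟩
    exact ⟨_, _, unit_prepend _ _ (PreGerm.act_eq ⟨x, ξ, h⟩)⟩
  · rintro ⟨ξ, h, e⟩
    have hξ : x.β.src = (ξ.act x.g⁻¹).rng := by
      rw [InfPath.rng_act, ← show x.α.src = ξ.rng from h, x.src_eq, inv_smul_smul]
    refine ⟨_, ⟨ξ.act x.g⁻¹, hξ, rfl⟩, Subtype.ext ?_⟩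
    refine Eq.trans ?_ ((unit_prepend x.α ξ h).trans e.symm)
    refine congrArg unit ?_
    simp only [rngPath, mk, Quotient.lift_mk, PreGerm.target, InfPath.act_act_inv]

theorem isOpenMap_rng : IsOpenMap (rng : T.Germ → units T.Germ) := by
  refine isTopologicalBasis_bisection.isOpenMap_iff.2 ?_
  rintro _ ⟨x, rfl⟩
  rw [image_rng_bisection]
  exact (isOpen_bisection _).preimage continuous_subtype_val

theorem injOn_rng_bisection (x : T.Triple) : Set.InjOn rng (bisection x) := by
  rintro _ ⟨ξ, h, rfl⟩ _ ⟨η, k, rfl⟩ e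
  have e1 := FinPath.prepend_inj (h := PreGerm.act_eq ⟨x, ξ, h⟩) (h' := PreGerm.act_eq ⟨x, η, k⟩)
    (unit_inj (congrArg Subtype.val e))
  have e2 : ξ = η := by
    rw [← ξ.act_inv_act x.g, ← η.act_inv_act x.g]
    exact congrArg _ e1
  subst e2
  rfl

theorem isLocalHomeomorph_rng : IsLocalHomeomorph (rng : T.Germ → units T.Germ) := by
  refine isLocalHomeomorph_iff_isOpenEmbedding_restrict.2 fun γ => ?_
  obtain ⟨_, ⟨x, rfl⟩, hγ, -⟩ :=
    isTopologicalBasis_bisection.exists_subset_of_mem_open (Set.mem_univ γ) isOpen_univ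
  exact ⟨bisection x, (isOpen_bisection x).mem_nhds hγ,
    .of_continuous_injective_isOpenMap (continuous_rng.comp continuous_subtype_val)
      (injOn_rng_bisection x).injective (isOpenMap_rng.domRestrict (isOpen_bisection x))⟩

/-! ### Continuity of inversion and multiplication -/

theorem continuous_inv : Continuous (ArrowGroupoid.inv : T.Germ → T.Germ) := by
  refine isTopologicalBasis_bisection.continuous_iff.2 ?_
  rintro _ ⟨x, rfl⟩
  have key : ∀ (x : T.Triple) (γ : T.Germ), γ ∈ bisection x →
      ArrowGroupoid.inv γ ∈ bisection x.star := by
    rintro x _ ⟨ξ, h, rfl⟩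
    exact ⟨_, PreGerm.act_eq ⟨x, ξ, h⟩, rfl⟩
  have : ArrowGroupoid.inv ⁻¹' bisection x = bisection x.star := by
    ext γ
    refine ⟨fun h => inv_inv γ ▸ key _ _ h, fun h => ?_⟩
    have hs : x.star.star = x := Triple.ext rfl (_root_.inv_inv x.g) rfl
    exact hs ▸ key _ _ h
  rw [this]
  exact isOpen_bisection _

theorem mul_mk (x y : T.Triple) (h : x.β = y.α) (ξ : T.InfPath) (k : y.β.src = ξ.rng)
    (l : x.β.src = (ξ.act y.g).rng) :
    ArrowGroupoid.mul (mk ⟨x, ξ.act y.g, l⟩) (mk ⟨y, ξ, k⟩) = mk ⟨x.comp y h, ξ, k⟩ := by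
  refine IsMul.mul_eq ⟨_, _, rfl, rfl, ?_, Triple.mul_of_eq x y h, rfl⟩
  simp only [PreGerm.base, PreGerm.target, h]

theorem act_eq_of_composable {x y : T.Triple} (h : x.β = y.α) {ξ η : T.InfPath}
    {l : x.β.src = η.rng} {k : y.β.src = ξ.rng}
    (e : ArrowGroupoid.s (mk ⟨x, η, l⟩) = ArrowGroupoid.r (mk ⟨y, ξ, k⟩)) : η = ξ.act y.g := by
  have e1 : x.β.prepend η l = y.α.prepend (ξ.act y.g) (PreGerm.act_eq ⟨y, ξ, k⟩) := unit_inj e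
  obtain ⟨α, g, β, hx⟩ := x
  obtain rfl : β = y.α := h
  exact FinPath.prepend_inj e1

/-- Composable germs have composable representatives. -/
theorem exists_composable {γ δ : T.Germ} (h : ArrowGroupoid.s γ = ArrowGroupoid.r δ) :
    ∃ (x y : T.Triple) (ξ : T.InfPath) (l : x.β.src = (ξ.act y.g).rng) (k : y.β.src = ξ.rng),
      x.β = y.α ∧ γ = mk ⟨x, ξ.act y.g, l⟩ ∧ δ = mk ⟨y, ξ, k⟩ := by
  induction γ using Quotient.ind with
  | _ p =>
    induction δ using Quotient.ind with
    | _ q =>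
      have e : p.base = q.target := unit_inj h
      -- Each inner path is lengthened by the length of the other; both become the initial segment
      -- of the same length of the same infinite path.
      have hxy : (p.x.extend (p.ξ.initial q.x.α.length) p.src_eq).β =
          (q.x.extend (q.ξ.initial p.x.β.length) q.src_eq).α := by
        rw [extend_initial_α, extend_initial_β, e, add_comm]
      have hp := mk_extend_initial p q.x.α.length
      have hq := mk_extend_initial q p.x.β.length
      change ArrowGroupoid.s (mk p) = ArrowGroupoid.r (mk q) at h
      rw [← hp, ← hq] at h
      have hξ := act_eq_of_composable hxy h
      refine ⟨_, _, _, ?_, _, hxy, ?_, hq.symm⟩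
      · rw [← hξ]
        exact (p.x.src_extend _ p.src_eq).trans (p.ξ.src_initial _)
      · refine hp.symm.trans ?_
        congr 1
        exact PreGerm.ext rfl hξ

/-- For matching representatives `x`, `y` with tail `ξ`, a neighbourhood of the product contains the
bisection of the composite extended by some `ξ|ₙ`. Extending `y` by `ξ|ₙ` and `x` by its translate
under `y.g` gives bisections whose composable products all land there. -/
theorem continuous_mul : Continuous fun p : {p : T.Germ × T.Germ //
    ArrowGroupoid.s p.1 = ArrowGroupoid.r p.2} => ArrowGroupoid.mul p.1.1 p.1.2 := by
  refine continuous_def.2 fun O hO => isOpen_iff_mem_nhds.2 ?_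
  rintro ⟨⟨γ, δ⟩, hγδ⟩ hm
  obtain ⟨x, y, ξ, l, k, h, rfl, rfl⟩ := exists_composable hγδ
  rw [Set.mem_preimage, mul_mk x y h ξ k l] at hm
  obtain ⟨n, hn⟩ := exists_extend_subset _ hO hm
  have l' : x.β.src = ((ξ.initial n).act y.g).rng := l.trans (InfPath.rng_act _ _)
  have k' : y.β.src = (ξ.initial n).rng := k
  have h1 : mk ⟨x, ξ.act y.g, l⟩ ∈ bisection (x.extend ((ξ.initial n).act y.g) l') := by
    simp only [InfPath.act_initial]
    exact mem_bisection_extend ⟨x, ξ.act y.g, l⟩ n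
  have h2 : mk ⟨y, ξ, k⟩ ∈ bisection (y.extend (ξ.initial n) k') :=
    mem_bisection_extend ⟨y, ξ, k⟩ n
  have hN := ((isOpen_bisection (x.extend ((ξ.initial n).act y.g) l')).prod
    (isOpen_bisection (y.extend (ξ.initial n) k'))).preimage (continuous_subtype_val (p := fun p : T.Germ × T.Germ =>
      ArrowGroupoid.s p.1 = ArrowGroupoid.r p.2))
  refine Filter.mem_of_superset (hN.mem_nhds ⟨h1, h2⟩) ?_
  rintro ⟨⟨γ', δ'⟩, hc⟩ ⟨⟨ξ₁, l₁, rfl⟩, ⟨ξ₂, l₂, rfl⟩⟩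
  have hβα : (x.extend ((ξ.initial n).act y.g) l').β = (y.extend (ξ.initial n) k').α := by
    simp only [Triple.extend, h]
  obtain rfl := act_eq_of_composable hβα hc
  rw [Set.mem_preimage, mul_mk _ _ hβα ξ₂ l₂ l₁]
  exact hn ⟨ξ₂, l₂, by
    congr 1
    exact PreGerm.ext (Triple.extend_comp_extend x y h _ k' l' hβα) rfl⟩

/-! ### Ampleness, and the kernel of the lag cocycle -/

variable (T) in
theorem isAmple [Finite E] (hT : T2Space T.Germ) : IsAmple T.Germ := by
  let _ : TopologicalSpace E := ⊥
  have : DiscreteTopology E := ⟨rfl⟩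
  have hemb := isClosedEmbedding_units (T := T)
  -- Here finiteness of `E` enters: the space of all edge sequences is compact, and the unit space
  -- is closed in it.
  have : CompactSpace (units T.Germ) := hemb.compactSpace
  have : TotallyDisconnectedSpace (units T.Germ) :=
    hemb.isEmbedding.isTotallyDisconnected_range.1
      (isTotallyDisconnected_of_totallyDisconnectedSpace _)
  exact {
    continuous_inv := continuous_inv
    continuous_mul := continuous_mul
    hausdorff := hT
    locallyCompact_units := inferInstance
    isLocalHomeomorph_rng := isLocalHomeomorph_rng
    zeroDimensional_units := isTopologicalBasis_isClopen }

/-- Source, range and lag determine a germ, and here all three agree with those of the unit.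
Principality of the kernel is this remark. -/
theorem eq_unit_of_mem_ker {γ : T.Germ} (h : T.lagCocycle γ = 1)
    (e : γ.rngPath = γ.srcPath) : γ = unit γ.srcPath :=
  ext' (srcPath_unit _).symm (e.trans (rngPath_unit _).symm)
    (Eq.trans h (lagFun_unit _).symm)

end Germ

variable (T) in
theorem isPrincipal_ker_lagCocycle : ArrowGroupoid.IsPrincipal T.lagCocycle.ker.carrier := by
  ext ⟨γ, hγ⟩
  refine Subtype.ext_iff.trans (Iff.trans ?_ Subtype.ext_iff.symm)
  change Germ.unit γ.rngPath = Germ.unit γ.srcPath ↔ Germ.unit γ.rngPath = γ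
  constructor
  · intro h
    rw [h]
    exact (Germ.eq_unit_of_mem_ker hγ (Germ.unit_inj h)).symm
  · intro h
    conv_rhs => rw [← h]
    rw [Germ.srcPath_unit]

variable (T) in
/-- The kernel of the lag function consists of the germs `[α, 1, β; βξ]` with `|α| = |β|`. -/
theorem ker_lagCocycle : {γ : T.Germ | T.lagCocycle γ = 1} =
    {γ | ∃ (α β : T.FinPath) (h : α.src = β.src) (ξ : T.InfPath) (hξ : β.src = ξ.rng),
      α.length = β.length ∧ γ = Germ.mk ⟨Triple.ofPair α β h, ξ, hξ⟩} := by
  -- Obtained by comparing `p` with the unit at its source, whose paths have length zero and whose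
  -- cocycle sequence is constantly `1`.
  have hlag : ∀ (p : T.PreGerm), p.lag = 1 ↔
      p.x.α.length = p.x.β.length ∧ ∃ N, ∀ n ≥ N, p.ξ.Phi p.x.g n = 1 := by
    intro p
    rw [← PreGerm.lag_unit p.base, PreGerm.lag_eq_iff]
    simp [PreGerm.unit, Triple.ofPair, FinPath.ofVertex, FinPath.length, InfPath.Phi_one]
  ext γ
  induction γ using Quotient.ind with
  | _ p =>
    constructor
    · intro h
      obtain ⟨hl, N, hN⟩ := (hlag p).1 h
      -- The group element of the extension is `φ(g, ξ|_N)`, so extending past the finitely many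
      -- nontrivial entries yields a representative of the required form.
      have hg : (p.x.extend (p.ξ.initial N) p.src_eq).g = 1 := hN N le_rfl
      have hs : (p.x.extend (p.ξ.initial N) p.src_eq).α.src =
          (p.x.extend (p.ξ.initial N) p.src_eq).β.src := by rw [Triple.src_eq, hg, one_smul]
      have hx : p.x.extend (p.ξ.initial N) p.src_eq = Triple.ofPair _ _ hs :=
        Triple.ext rfl hg rfl
      refine ⟨_, _, hs, _, (p.x.src_extend _ p.src_eq).trans (p.ξ.src_initial N), ?_,
        (Germ.mk_extend_initial p N).symm.trans ?_⟩
      · rw [Germ.extend_initial_α, Germ.extend_initial_β, InfPath.length_initial,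
          InfPath.length_initial, hl]
      · congr 1
        exact PreGerm.ext hx rfl
    · rintro ⟨α, β, h, ξ, hξ, hl, e⟩
      exact (congrArg Germ.lagFun e).trans <| (hlag _).2 ⟨hl, 0, fun n _ => T.cocList_one _⟩

end

end GraphTriple

theorem corollary6p8 {G V E : Type*} [Group G] [Finite V] [Finite E] [MulAction G V]
    [MulAction G E] (T : GraphTriple G V E) (hT2 : T2Space T.Germ) :
    -- the kernel of the lag function
    {γ : T.Germ | T.lagCocycle γ = 1} =
      {γ | ∃ (α β : T.FinPath) (h : α.src = β.src) (ξ : T.InfPath) (hξ : β.src = ξ.rng),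
        α.length = β.length ∧ γ = GraphTriple.Germ.mk ⟨GraphTriple.Triple.ofPair α β h, ξ, hξ⟩} ∧
    ArrowGroupoid.IsPrincipal T.lagCocycle.ker.carrier ∧
    -- the lag function satisfies the condition on the kernel in the theorem on graded ideals
    ArrowGroupoid.IsAmple T.Germ ∧
    ArrowGroupoid.IsStronglyEffective T.lagCocycle.ker.carrier ∧
    -- the conclusion of that theorem, for which the cocycle has to be locally constant:
    -- `A_K(𝒢)` is graded by the lag group, and `U ↦ A_K(𝒢|_U)` is an isomorphism from the
    -- lattice of open invariant sets of units onto the lattice of graded ideals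
    (IsLocallyConstant T.lagCocycle → ∀ (K : Type*) [Field K],
      ArrowGroupoid.IsGrading K (ArrowGroupoid.homogeneous K T.lagCocycle) ∧
      ∃ Ψ : {U : Set (ArrowGroupoid.units T.Germ) // IsOpen U ∧ ArrowGroupoid.IsInvariant U} ≃o
          {J : Submodule K (T.Germ → K) //
            ArrowGroupoid.IsGradedIdeal (ArrowGroupoid.homogeneous K T.lagCocycle) J},
        ∀ U, (Ψ U : Submodule K (T.Germ → K)) =
          ArrowGroupoid.steinbergOn K T.Germ (ArrowGroupoid.restrict U.1 U.2.2).carrier) := by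
  have hA := GraphTriple.Germ.isAmple T hT2
  have hp := GraphTriple.isPrincipal_ker_lagCocycle T
  refine ⟨GraphTriple.ker_lagCocycle T, hp, hA,
    ArrowGroupoid.isStronglyEffective_of_isPrincipal hp ?_, fun hc K _ =>
      ⟨ArrowGroupoid.isGrading_homogeneous hA hc,
        ArrowGroupoid.exists_orderIso_gradedIdeals hA hc hp⟩⟩
  rw [ArrowGroupoid.units_sub]
  exact hA.isOpen_units.preimage continuous_subtype_val
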